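/- Let $n,d\in\mathbb N$ and $\beta,\Theta>0$. Let $K:\mathbb R\to\mathbb R^{n\times d}$ be square integrable with $K(t)=0$ for $t<0$, with rows $K_1,\dots,K_n$ satisfying $$\int_{-\infty}^{-t}\langle K_j(-u),K_j(-u)\rangle\,du\le\Theta\,(1\wedge t^{-2\beta})\qquad\text{for all }t\ge0,\ j=1,\dots,n ,$$ and let $(W_t)_{t\in\mathbb R}$ be a $d$-dimensional two-sided standard Wiener process. Let $y=(y_t)_{t\ge0}$ be an $\mathbb R^n$-valued process which has the same law as the moving average $v_t=\int_{\mathbb R}K(t-u)\,dW_u$, $t\ge0$ (that is, $y\in\mathcal V_n(\beta,\Theta)$ with kernel $K$). Assume that $\Sigma=\mathbb E[y_0\otimes y_0]$ has rank $n$, let $O$ be an orthogonal matrix and $D$ a diagonal matrix with $O^\top\Sigma O=D$, and set $\hat\Theta=|D^{-1/2}O^\top|^2\,\Theta$, where $|\cdot|$ is the Euclidean operator norm. Let $H_{\ell}(x)=\prod_{i=1}^nH_{\ell_i}(x_i)$, $\ell\in\mathbb N_0^n$, be the (monic, probabilists') Hermite polynomials. For $G\in L^2(\mathbb R^n,N(0,\Sigma))$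 let $c_\ell=\frac1{\ell!}\int G(OD^{1/2}x)H_\ell(x)\,N(0,\mathrm{id})(dx)$ be the coefficients of the expansion $G(OD^{1/2}\,\cdot)=\sum_\ell c_\ell H_\ell$ in $L^2(N(0,\mathrm{id}))$. The Hermite rank of $G$ is $\mathsf H(G)=\inf\{|\ell|:c_\ell\ne0\}\in\mathbb N_0\cup\{\infty\}$, and $G$ satisfies the fast chaos decay condition with parameter $p$ if $\sum_{\ell}|c_\ell|\,(p-1)^{|\ell|/2}\sqrt{\ell!}<\infty$. Then every $G\in L^2(\mathbb R^n,N(0,\Sigma))$ with $\mathsf H(G)>2/\beta$ which satisfies the fast chaos decay condition with parameter $\hat\Theta(2n-1)+1$ also satisfies the conditional decay condition with respect to $y$: $\mathbb E[G(y_0)]=0$ and $$\int_0^\infty\big\|\mathbb E[G(y_s)\,|\,\mathcal F_0]\big\|_{L^2}\,ds<\infty ,$$ where $\mathcal F_0=\sigma(W_s,\ s\le0)$ and the conditional expectation is formed for the realization $y_s=v_s$ driven by $W$. -/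

import Mathlib

open MeasureTheory ProbabilityTheory Filter Topology
open scoped NNReal ENNReal Matrix Nat RealInnerProductSpace

noncomputable section

namespace Volterra

/-- Euclidean space `ℝᵏ`. -/
abbrev E (k : ℕ) : Type := EuclideanSpace ℝ (Fin k)

/-! ### Two-sided Wiener process and Wiener integral -/

/-- `W` is a standard `d`-dimensional two-sided Wiener process under `μ`: it starts from `0` at
time `0`, has independent increments over `ℝ`, the increment over `[s, t]` has law
`N(0, (t - s) id)`, and almost every path is continuous. -/
structure IsWienerProcess {Ω : Type*} [MeasurableSpace Ω] (μ : Measure Ω) {d : ℕ}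
    (W : ℝ → Ω → E d) : Prop where
  measurable : ∀ t, Measurable (W t)
  zero : ∀ᵐ ω ∂μ, W 0 ω = 0
  indep : HasIndepIncrements W μ
  law : ∀ s t : ℝ, s ≤ t →
    HasLaw (fun ω ↦ W t ω - W s ω)
      (multivariateGaussian 0 ((t - s) • (1 : Matrix (Fin d) (Fin d) ℝ))) μ
  continuous : ∀ᵐ ω ∂μ, Continuous fun t ↦ W t ω

/-- The σ-algebra `ℱ_t = σ(W_s, s ≤ t)` generated by `W` up to time `t`. -/
@[reducible]
def wienerFiltration {Ω : Type*} {d : ℕ} (W : ℝ → Ω → E d) (t : ℝ) : MeasurableSpace Ω :=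
  ⨆ s ≤ t, MeasurableSpace.comap (W s) inferInstance

/-- An `ℝᵈ`-valued step function `∑ i, v i · 1_{(a i, b i]}` on the line. -/
structure StepFunction (d : ℕ) where
  size : ℕ
  a : Fin size → ℝ
  b : Fin size → ℝ
  a_le_b : ∀ i, a i ≤ b i
  v : Fin size → E d

/-- The function `∑ i, v i · 1_{(a i, b i]}`. -/
def StepFunction.eval {d : ℕ} (f : StepFunction d) (u : ℝ) : E d :=
  ∑ i, (Set.Ioc (f.a i) (f.b i)).indicator (fun _ ↦ f.v i) u

/-- The elementary integral `∑ i, ⟨v i, W_{b i} - W_{a i}⟩`. -/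
def StepFunction.integral {d : ℕ} {Ω : Type*} (f : StepFunction d) (W : ℝ → Ω → E d) (ω : Ω) : ℝ :=
  ∑ i, ⟪f.v i, W (f.b i) ω - W (f.a i) ω⟫

/-- `X` is (a version of) the Wiener integral `∫_ℝ ⟨h(u), dW_u⟩` of the square-integrable function
`h`: it is the `L²(μ)`-limit of the elementary integrals of step functions converging to `h` in
`L²(ℝ; ℝᵈ)`. -/
def IsWienerIntegral {Ω : Type*} [MeasurableSpace Ω] (μ : Measure Ω) {d : ℕ}
    (W : ℝ → Ω → E d) (h : ℝ → E d) (X : Ω → ℝ) : Prop :=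
  MemLp h 2 volume ∧ MemLp X 2 μ ∧ ∃ f : ℕ → StepFunction d,
    Tendsto (fun k ↦ eLpNorm (fun u ↦ (f k).eval u - h u) 2 volume) atTop (𝓝 0) ∧
    Tendsto (fun k ↦ eLpNorm (fun ω ↦ (f k).integral W ω - X ω) 2 μ) atTop (𝓝 0)

/-! ### Volterra processes -/

/-- The `j`-th row of the kernel `K`, as a function with values in `ℝᵈ`. -/
def kernelRow {n d : ℕ} (K : ℝ → Matrix (Fin n) (Fin d) ℝ) (j : Fin n) (u : ℝ) : E d :=
  WithLp.toLp 2 (K u j)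

/-- The process `(v_t)_{t ≥ 0}` is the moving average `v_t = ∫_ℝ K(t - u) dW_u` driven by `W`
(for every `t`, up to a null set). -/
def IsMovingAverage {Ω : Type*} [MeasurableSpace Ω] (μ : Measure Ω) {n d : ℕ}
    (W : ℝ → Ω → E d) (K : ℝ → Matrix (Fin n) (Fin d) ℝ) (v : ℝ≥0 → Ω → E n) : Prop :=
  ∀ (t : ℝ≥0) (j : Fin n),
    IsWienerIntegral μ W (fun u ↦ kernelRow K j (t - u)) (fun ω ↦ v t ω j)

/-- The process `y` on `(Ω', P)` is a stationary Volterra process, represented by the square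
integrable causal kernel `K` and by the Wiener process `W` on `(Ω, μ)`: it has the same
finite-dimensional distributions as `v_t = ∫_ℝ K(t - u) dW_u`. -/
structure IsVolterraProcess {Ω' : Type*} [MeasurableSpace Ω'] (P : Measure Ω') {n d : ℕ}
    (y : ℝ≥0 → Ω' → E n) {Ω : Type*} [MeasurableSpace Ω] (μ : Measure Ω)
    (W : ℝ → Ω → E d) (K : ℝ → Matrix (Fin n) (Fin d) ℝ) (v : ℝ≥0 → Ω → E n) : Prop where
  wiener : IsWienerProcess μ W
  sq_integrable : ∀ j, MemLp (kernelRow K j) 2 volume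
  causal : ∀ t < 0, K t = 0
  moving_average : IsMovingAverage μ W K v
  law_eq : ∀ I : Finset ℝ≥0,
    IdentDistrib (fun ω' (t : I) ↦ y t ω') (fun ω (t : I) ↦ v t ω) P μ

/-- The tail condition `∫_{-∞}^{-t} ⟨K_j(-u), K_j(-u)⟩ du ≤ Θ (1 ∧ t^{-2β})` for all `t ≥ 0` and all
rows `K_j`. Here `1 ∧ t^{-2β}` is written as `(1 ∨ t)^{-2β}`, which gives the value `1` at
`t = 0`, in agreement with `0^{-2β} = ∞`. -/
def KernelDecay {n d : ℕ} (K : ℝ → Matrix (Fin n) (Fin d) ℝ) (β Θ : ℝ) : Prop :=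
  ∀ t : ℝ, 0 ≤ t → ∀ j : Fin n,
    |∫ u in Set.Iic (-t), ⟪kernelRow K j (-u), kernelRow K j (-u)⟫| ≤ Θ * (max 1 t) ^ (-(2 * β))

/-- The matrix `Σ = E[y₀ ⊗ y₀]`. -/
def secondMoment {Ω' : Type*} [MeasurableSpace Ω'] (P : Measure Ω') {n : ℕ}
    (y : ℝ≥0 → Ω' → E n) : Matrix (Fin n) (Fin n) ℝ :=
  Matrix.of fun i j ↦ ∫ ω', y 0 ω' i * y 0 ω' j ∂P

/-! ### Hermite expansion -/

/-- The matrix `D^{1/2}`, where `D` is the diagonal matrix with the given entries. -/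
def sqrtDiag {n : ℕ} (D : Fin n → ℝ) : Matrix (Fin n) (Fin n) ℝ :=
  Matrix.diagonal fun i ↦ √(D i)

/-- The matrix `D^{-1/2}`, where `D` is the diagonal matrix with the given (positive) entries. -/
def invSqrtDiag {n : ℕ} (D : Fin n → ℝ) : Matrix (Fin n) (Fin n) ℝ :=
  Matrix.diagonal fun i ↦ (√(D i))⁻¹

/-- The constant `Θ̂ = |D^{-1/2} Oᵀ|² Θ`, with the Euclidean operator norm. -/
def thetaHat {n : ℕ} (O : Matrix (Fin n) (Fin n) ℝ) (D : Fin n → ℝ) (Θ : ℝ) : ℝ :=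
  ‖Matrix.toEuclideanCLM (𝕜 := ℝ) (invSqrtDiag D * Oᵀ)‖ ^ 2 * Θ

/-- The multivariate (probabilists') Hermite polynomial `H_ℓ(x) = ∏ i, H_{ℓ i}(x i)`. -/
def hermiteMulti {n : ℕ} (l : Fin n → ℕ) (x : E n) : ℝ :=
  ∏ i, Polynomial.aeval (x i) (Polynomial.hermite (l i))

/-- The coefficient `c_ℓ` of `H_ℓ` in the expansion `G(O D^{1/2} x) = ∑ ℓ, c_ℓ H_ℓ(x)` in
`L²(N(0, id))`. Since `‖H_ℓ‖² = ℓ!`, this is `(1 / ℓ!) ∫ G(O D^{1/2} x) H_ℓ(x) N(0, id)(dx)`. -/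
def hermiteCoeff {n : ℕ} (O : Matrix (Fin n) (Fin n) ℝ) (D : Fin n → ℝ) (G : E n → ℝ)
    (l : Fin n → ℕ) : ℝ :=
  (∏ i, ((l i)! : ℝ))⁻¹ *
    ∫ x, G (Matrix.toEuclideanCLM (𝕜 := ℝ) (O * sqrtDiag D) x) * hermiteMulti l x
      ∂(stdGaussian (E n))

/-- The Hermite rank `inf {|ℓ| : c_ℓ ≠ 0}`, which is `∞` if all `c_ℓ` vanish. -/
def hermiteRank {n : ℕ} (O : Matrix (Fin n) (Fin n) ℝ) (D : Fin n → ℝ) (G : E n → ℝ) : ℕ∞ :=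
  ⨅ (l : Fin n → ℕ) (_ : hermiteCoeff O D G l ≠ 0), ((∑ i, l i : ℕ) : ℕ∞)

/-- The fast chaos decay condition with parameter `p`:
`∑ ℓ, |c_ℓ| (p - 1)^{|ℓ| / 2} √(ℓ!) < ∞`. -/
def FastChaosDecay {n : ℕ} (O : Matrix (Fin n) (Fin n) ℝ) (D : Fin n → ℝ) (G : E n → ℝ)
    (p : ℝ) : Prop :=
  Summable fun l : Fin n → ℕ ↦
    |hermiteCoeff O D G l| * (p - 1) ^ (((∑ i, l i : ℕ) : ℝ) / 2) * √(∏ i, ((l i)! : ℝ))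

/-! ### The conditional decay condition -/

/-- The conditional decay condition for `G`: `G(y₀)` is centered and
`∫_0^∞ ‖E[G(y_s) | ℱ_0]‖_{L²} ds < ∞`. The conditional expectation is formed for the realization
`v_t = ∫_ℝ K(t - u) dW_u` of `y`, on the probability space of the driving Wiener process `W`, and
`ℱ_0 = σ(W_s, s ≤ 0)`. -/
structure ConditionalDecay {Ω' : Type*} [MeasurableSpace Ω'] (P : Measure Ω') {n d : ℕ}
    (y : ℝ≥0 → Ω' → E n) {Ω : Type*} [MeasurableSpace Ω] (μ : Measure Ω)
    (W : ℝ → Ω → E d) (v : ℝ≥0 → Ω → E n) (G : E n → ℝ) : Prop where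
  integrable_zero : Integrable (fun ω' ↦ G (y 0 ω')) P
  centered : ∫ ω', G (y 0 ω') ∂P = 0
  integrable : ∀ s : ℝ≥0, Integrable (fun ω ↦ G (v s ω)) μ
  decay : ∫⁻ s in Set.Ici (0 : ℝ),
    eLpNorm (μ[fun ω ↦ G (v s.toNNReal ω) | wienerFiltration W 0]) 2 μ < ∞

end Volterra

end

/-! Split `v_s = a + b`, where `a = E[v_s | ℱ_0]` is the Wiener integral over `(-∞, 0]` and `b` is
independent of `ℱ_0`. Whitening with `N = D^{-1/2} Oᵀ` makes `N v_s` standard Gaussian and replaces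
`G` by `F = G ∘ (O D^{1/2})`, whose Hermite coefficients vanish below degree `k = ⌊2/β⌋ + 1`. The
Wiener isometry and the kernel decay give `Cov(N a) ≤ c id` with `c = min(1, C (1 ∨ s)^{-2β})`.

If `Cov(N a)` were exactly `c id`, the conditional expectation would be the Ornstein-Uhlenbeck
average `x ↦ ∫ F(√c x + √(1-c) y) N(0, id)(dy)`. The Hermite polynomials are a complete orthogonal
system of eigenfunctions with eigenvalues `√c ^ |ℓ|`, so Parseval bounds its norm by `√c ^ k ‖F‖`
(`eLpNorm_ouOperator_le`). In general an independent Gaussian with the missing covariance `c id -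
Cov(N a)` is moved from `N b` to `N a`. This amounts to conditioning on more information, which by
Jensen can only increase the `L²`-norm (`lintegral_enorm_integral_conv_sq_le`,
`eLpNorm_condExp_comp_add_le`). Hence `‖E[G(v_s) | ℱ_0]‖` is at most a constant times `(1 ∨
s)^{-βk}`, which is integrable because `βk > 2`.

The probabilistic input is that the `L²`-closure of the span of `W` consists of jointly Gaussian
variables, so orthogonality to the past is independence of it (`indep_wienerFiltration`), and that
conditioning a Wiener integral on `ℱ_0` restricts its integrand to the negative half line
(`IsWienerIntegral.condExp`). -/

noncomputable section

namespace Volterra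

/-! ### Hermite polynomials of one variable -/

section Hermite

open Polynomial

/-- The `k`-th Hermite polynomial, with real coefficients. -/
def realHermite (k : ℕ) : ℝ[X] := (hermite k).map (Int.castRingHom ℝ)

lemma aeval_hermite_eq (k : ℕ) (x : ℝ) : aeval x (hermite k) = (realHermite k).eval x := by
  simp [realHermite, aeval_def, eval_map]

@[simp] lemma realHermite_zero : realHermite 0 = 1 := by simp [realHermite]

lemma realHermite_succ (k : ℕ) :
    realHermite (k + 1) = X * realHermite k - derivative (realHermite k) := by
  simp [realHermite, hermite_succ, derivative_map]

lemma derivative_realHermite_succ (k : ℕ) :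
    derivative (realHermite (k + 1)) = C ((k : ℝ) + 1) * realHermite k := by
  induction k with
  | zero => simp [realHermite_succ]
  | succ k ih =>
    rw [realHermite_succ (k + 1), derivative_sub, derivative_mul, derivative_X, ih,
      derivative_C_mul, realHermite_succ k]
    simp only [Nat.cast_add, Nat.cast_one, C_add, C_1]
    ring

lemma X_mul_realHermite_succ (k : ℕ) :
    X * realHermite (k + 1) = realHermite (k + 2) + C ((k : ℝ) + 1) * realHermite k := by
  rw [realHermite_succ (k + 1), derivative_realHermite_succ]
  ring

lemma integrable_eval_gaussianReal (p : ℝ[X]) {v : ℝ≥0} :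
    Integrable (fun x ↦ p.eval x) (gaussianReal 0 v) := by
  induction p using Polynomial.induction_on' with
  | add p q hp hq =>
    simp only [eval_add]
    exact hp.add hq
  | monomial n a =>
    simp only [eval_monomial]
    have h := (memLp_id_gaussianReal (μ := 0) (v := v) (n : ℝ≥0)).integrable_norm_pow'
    refine Integrable.const_mul ?_ a
    refine (integrable_norm_iff (by fun_prop)).1 ?_
    simpa using h

/-- Gaussian integration by parts: the derivative of density times `p` is integrable and has total
integral zero, and the density `φ` satisfies `φ' = -x φ`. -/
lemma integral_X_mul_gaussianReal (p : ℝ[X]) :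
    ∫ x, (X * p).eval x ∂(gaussianReal 0 1) = ∫ x, (derivative p).eval x ∂(gaussianReal 0 1) := by
  have hint (q : ℝ[X]) : Integrable (fun x ↦ gaussianPDFReal 0 1 x * q.eval x) := by
    have := integrable_eval_gaussianReal q (v := 1)
    rw [gaussianReal_of_var_ne_zero _ one_ne_zero, integrable_withDensity_iff_integrable_smul'
      (by fun_prop) (by simp [gaussianPDF_lt_top])] at this
    simpa [toReal_gaussianPDF] using this
  have hderiv (x : ℝ) : HasDerivAt (fun x ↦ gaussianPDFReal 0 1 x * p.eval x)
      (gaussianPDFReal 0 1 x * (derivative p - X * p).eval x) x := by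
    have h1 : HasDerivAt (gaussianPDFReal 0 1) (-x * gaussianPDFReal 0 1 x) x := by
      have h := (((hasDerivAt_id x).pow 2).neg.div_const 2).exp.const_mul (√(2 * Real.pi))⁻¹
      have h2 : gaussianPDFReal 0 1 =
          fun x ↦ (√(2 * Real.pi))⁻¹ * Real.exp (-x ^ 2 / 2) := by
        ext x; simp [gaussianPDFReal]
      rw [h2]
      refine h.congr_deriv ?_
      simp only [id_eq, Pi.pow_apply, Pi.neg_apply]
      ring
    refine (h1.mul (p.hasDerivAt x)).congr_deriv ?_
    simp only [eval_sub, eval_mul, eval_X]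
    ring
  have h0 := integral_eq_zero_of_hasDerivAt_of_integrable hderiv (hint _) (hint _)
  rw [integral_gaussianReal_eq_integral_smul one_ne_zero,
    integral_gaussianReal_eq_integral_smul one_ne_zero]
  simp only [smul_eq_mul]
  simp only [eval_sub, mul_sub] at h0
  rw [integral_sub (hint _) (hint _)] at h0
  linarith

/-- The raising operator `X - d/dx` is adjoint to `d/dx` under the Gaussian measure. Iterating this
proves orthogonality. -/
lemma integral_realHermite_succ_mul (k : ℕ) (p : ℝ[X]) :
    ∫ x, (realHermite (k + 1) * p).eval x ∂(gaussianReal 0 1) =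
      ∫ x, (realHermite k * derivative p).eval x ∂(gaussianReal 0 1) := by
  have h := integral_X_mul_gaussianReal (realHermite k * p)
  rw [derivative_mul] at h
  simp only [eval_add] at h
  rw [integral_add (integrable_eval_gaussianReal _) (integrable_eval_gaussianReal _)] at h
  rw [realHermite_succ, sub_mul, mul_assoc]
  simp only [eval_sub]
  rw [integral_sub (integrable_eval_gaussianReal _) (integrable_eval_gaussianReal _), h]
  ring

lemma integral_realHermite_mul (k l : ℕ) :
    ∫ x, (realHermite k).eval x * (realHermite l).eval x ∂(gaussianReal 0 1) =
      if k = l then (k ! : ℝ) else 0 := by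
  simp_rw [← eval_mul]
  induction k generalizing l with
  | zero =>
    cases l with
    | zero => simp
    | succ l =>
      rw [mul_comm, integral_realHermite_succ_mul]
      simp
  | succ k ih =>
    rw [integral_realHermite_succ_mul]
    cases l with
    | zero => simp
    | succ l =>
      rw [derivative_realHermite_succ]
      simp_rw [mul_left_comm (realHermite k), eval_C_mul]
      rw [integral_const_mul, ih]
      by_cases h : k = l
      · subst h
        simp [Nat.factorial_succ]
      · simp [h]

/-- Hermite polynomials are eigenfunctions of the Ornstein-Uhlenbeck semigroup. -/
lemma integral_realHermite_comp (k : ℕ) {r s : ℝ} (hrs : r ^ 2 + s ^ 2 = 1) (x : ℝ) :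
    ∫ y, (realHermite k).eval (r * x + s * y) ∂(gaussianReal 0 1) =
      r ^ k * (realHermite k).eval x := by
  set q : ℝ[X] := C (r * x) + C s * X with hq
  have hcomp (p : ℝ[X]) (y : ℝ) : p.eval (r * x + s * y) = (p.comp q).eval y := by
    simp [hq, eval_comp]
  -- Integration by parts in `y`: one factor `s` comes from the coefficient of `y`, the other from
  -- the chain rule.
  have hstep (p : ℝ[X]) : ∫ y, (X * p).eval (r * x + s * y) ∂(gaussianReal 0 1) =
      r * x * ∫ y, p.eval (r * x + s * y) ∂(gaussianReal 0 1) +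
        s ^ 2 * ∫ y, (derivative p).eval (r * x + s * y) ∂(gaussianReal 0 1) := by
    simp_rw [hcomp]
    have h := integral_X_mul_gaussianReal (p.comp q)
    have h1 : (X * p).comp q = C (r * x) * p.comp q + C s * (X * p.comp q) := by
      rw [mul_comp, X_comp, hq]; ring
    have h2 : derivative (p.comp q) = C s * (derivative p).comp q := by
      rw [derivative_comp]; simp [hq]
    rw [h2] at h
    rw [h1]
    simp only [eval_add, eval_C_mul] at h ⊢
    rw [integral_add ((integrable_eval_gaussianReal _).const_mul _)
      ((integrable_eval_gaussianReal _).const_mul _), integral_const_mul, integral_const_mul, h,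
      integral_const_mul]
    ring
  have hint (p : ℝ[X]) : Integrable (fun y ↦ p.eval (r * x + s * y)) (gaussianReal 0 1) := by
    simp_rw [hcomp]; exact integrable_eval_gaussianReal _
  -- The recurrence involves two preceding polynomials, so the induction carries consecutive pairs.
  have key : ∀ k, ∫ y, (realHermite k).eval (r * x + s * y) ∂(gaussianReal 0 1) =
      r ^ k * (realHermite k).eval x ∧
      ∫ y, (realHermite (k + 1)).eval (r * x + s * y) ∂(gaussianReal 0 1) =
      r ^ (k + 1) * (realHermite (k + 1)).eval x := by
    intro k
    induction k with
    | zero =>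
      refine ⟨by simp, ?_⟩
      have := hstep 1
      simp only [mul_one, derivative_one, eval_one, eval_zero, integral_const] at this
      rw [zero_add, realHermite_succ]
      simp only [realHermite_zero, mul_one, derivative_one, sub_zero]
      rw [this]
      simp
    | succ k ih =>
      refine ⟨ih.2, ?_⟩
      rw [realHermite_succ (k + 1)]
      simp only [eval_sub]
      rw [integral_sub (hint _) (hint _), hstep, ih.2, derivative_realHermite_succ]
      simp only [eval_mul, eval_C, eval_X]
      rw [integral_const_mul, ih.1]
      have : s ^ 2 = 1 - r ^ 2 := by linarith
      rw [this]
      ring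
  exact (key k).1

end Hermite

/-! ### Hermite polynomials of several variables -/

lemma hermiteMulti_eq {n : ℕ} (l : Fin n → ℕ) (x : E n) :
    hermiteMulti l x = ∏ i, (realHermite (l i)).eval (x i) := by
  simp [hermiteMulti, aeval_hermite_eq]

lemma continuous_hermiteMulti {n : ℕ} (l : Fin n → ℕ) : Continuous (hermiteMulti l) := by
  have : hermiteMulti l = fun x : E n ↦ ∏ i, (realHermite (l i)).eval (x i) := by
    ext x; exact hermiteMulti_eq l x
  rw [this]
  fun_prop

lemma integral_prod_stdGaussian {n : ℕ} (f : Fin n → ℝ → ℝ) :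
    ∫ x, ∏ i, f i (x i) ∂(stdGaussian (E n)) = ∏ i, ∫ x, f i x ∂(gaussianReal 0 1) := by
  rw [← map_pi_eq_stdGaussian, ← MeasurableEquiv.coe_toLp, integral_map_equiv]
  simp only [MeasurableEquiv.coe_toLp]
  rw [integral_fintype_prod_eq_prod]

lemma integrable_prod_stdGaussian {n : ℕ} {f : Fin n → ℝ → ℝ}
    (hf : ∀ i, Integrable (f i) (gaussianReal 0 1)) :
    Integrable (fun x : E n ↦ ∏ i, f i (x i)) (stdGaussian (E n)) := by
  rw [← map_pi_eq_stdGaussian, ← MeasurableEquiv.coe_toLp, integrable_map_equiv]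
  exact Integrable.fintype_prod hf

lemma integrable_hermiteMulti_mul {n : ℕ} (k l : Fin n → ℕ) :
    Integrable (fun x ↦ hermiteMulti k x * hermiteMulti l x) (stdGaussian (E n)) := by
  simp_rw [hermiteMulti_eq, ← Finset.prod_mul_distrib, ← Polynomial.eval_mul]
  exact integrable_prod_stdGaussian fun i ↦ integrable_eval_gaussianReal _

lemma memLp_hermiteMulti {n : ℕ} (l : Fin n → ℕ) :
    MemLp (hermiteMulti l) 2 (stdGaussian (E n)) := by
  rw [memLp_two_iff_integrable_sq (continuous_hermiteMulti l).aestronglyMeasurable]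
  simpa [sq] using integrable_hermiteMulti_mul l l

lemma integral_hermiteMulti_mul {n : ℕ} (k l : Fin n → ℕ) :
    ∫ x, hermiteMulti k x * hermiteMulti l x ∂(stdGaussian (E n)) =
      if k = l then ∏ i, ((l i)! : ℝ) else 0 := by
  simp_rw [hermiteMulti_eq, ← Finset.prod_mul_distrib]
  rw [integral_prod_stdGaussian
    (f := fun i x ↦ (realHermite (k i)).eval x * (realHermite (l i)).eval x)]
  simp_rw [integral_realHermite_mul]
  split_ifs with h
  · simp [h]
  · obtain ⟨i, hi⟩ := Function.ne_iff.1 h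
    exact Finset.prod_eq_zero (Finset.mem_univ i) (by simp [hi])

lemma integral_hermiteMulti_comp {n : ℕ} (l : Fin n → ℕ) {r s : ℝ} (hrs : r ^ 2 + s ^ 2 = 1)
    (x : E n) :
    ∫ y, hermiteMulti l (r • x + s • y) ∂(stdGaussian (E n)) =
      r ^ (∑ i, l i) * hermiteMulti l x := by
  simp_rw [hermiteMulti_eq, PiLp.add_apply, PiLp.smul_apply, smul_eq_mul]
  rw [integral_prod_stdGaussian
    (f := fun i y ↦ (realHermite (l i)).eval (r * x i + s * y))]
  simp_rw [integral_realHermite_comp _ hrs, Finset.prod_mul_distrib, Finset.prod_pow_eq_pow_sum]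

/-- The span of the Hermite polynomials, as a space of functions. -/
def hermiteSpan (n : ℕ) : Submodule ℝ (E n → ℝ) := Submodule.span ℝ (Set.range hermiteMulti)

/-- The one-variable three-term recurrence, applied to the `i`-th factor only; `Function.update`
changes the index of that factor. -/
lemma coord_mul_hermiteMulti_mem {n : ℕ} (i : Fin n) (l : Fin n → ℕ) :
    (fun x : E n ↦ x i * hermiteMulti l x) ∈ hermiteSpan n := by
  have hup (k : Fin n → ℕ) (j : ℕ) (x : E n) : hermiteMulti (Function.update k i j) x =
      (realHermite j).eval (x i) * ∏ a ∈ Finset.univ.erase i, (realHermite (k a)).eval (x a) := by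
    rw [hermiteMulti_eq, ← Finset.mul_prod_erase _ _ (Finset.mem_univ i)]
    congr 1
    · simp
    · refine Finset.prod_congr rfl fun a ha ↦ ?_
      rw [Function.update_of_ne (Finset.ne_of_mem_erase ha)]
  have hmem (k : Fin n → ℕ) : hermiteMulti k ∈ hermiteSpan n := Submodule.subset_span ⟨k, rfl⟩
  have hl : l = Function.update l i (l i) := by simp
  cases hk : l i with
  | zero =>
    convert hmem (Function.update l i 1) using 1
    ext x
    rw [hl, hk, hup]
    simp [hup, realHermite_succ]
  | succ k =>
    convert (hermiteSpan n).add_mem (hmem (Function.update l i (k + 2)))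
      ((hermiteSpan n).smul_mem ((k : ℝ) + 1) (hmem (Function.update l i k))) using 1
    ext x
    have h := congrArg (Polynomial.eval (x i)) (X_mul_realHermite_succ k)
    simp only [Polynomial.eval_mul, Polynomial.eval_add, Polynomial.eval_X,
      Polynomial.eval_C] at h
    conv_lhs => rw [hl, hk, hup, ← mul_assoc, h]
    simp only [Pi.add_apply, Pi.smul_apply, smul_eq_mul, hup]
    ring

lemma coord_mul_mem {n : ℕ} (i : Fin n) {p : E n → ℝ} (hp : p ∈ hermiteSpan n) :
    (fun x : E n ↦ x i * p x) ∈ hermiteSpan n := by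
  induction hp using Submodule.span_induction with
  | mem p hp =>
    obtain ⟨l, rfl⟩ := hp
    exact coord_mul_hermiteMulti_mem i l
  | zero =>
    simp only [Pi.zero_apply, mul_zero]
    exact (hermiteSpan n).zero_mem
  | add p q _ _ hp hq =>
    convert (hermiteSpan n).add_mem hp hq using 1
    ext x; simp [mul_add]
  | smul c p _ hp =>
    convert (hermiteSpan n).smul_mem c hp using 1
    ext x; simp [mul_left_comm]

/-- These powers are the terms of the exponential series, which is how completeness reduces to
injectivity of the Fourier transform. -/
lemma inner_pow_mem_hermiteSpan {n : ℕ} (t : E n) (k : ℕ) :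
    (fun x : E n ↦ ⟪t, x⟫ ^ k) ∈ hermiteSpan n := by
  induction k with
  | zero =>
    refine Submodule.subset_span ⟨0, ?_⟩
    ext x; simp [hermiteMulti_eq]
  | succ k ih =>
    have h : (fun x : E n ↦ ⟪t, x⟫ ^ (k + 1)) =
        ∑ i, t i • fun x : E n ↦ x i * ⟪t, x⟫ ^ k := by
      ext x
      simp only [Finset.sum_apply, Pi.smul_apply, smul_eq_mul, pow_succ']
      rw [PiLp.inner_apply, Finset.sum_mul]
      simp only [RCLike.inner_apply, conj_trivial]
      exact Finset.sum_congr rfl fun i _ ↦ by ring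
    rw [h]
    exact Submodule.sum_mem _ fun i _ ↦ Submodule.smul_mem _ _ (coord_mul_mem i ih)

lemma memLp_of_mem_hermiteSpan {n : ℕ} {p : E n → ℝ} (hp : p ∈ hermiteSpan n) :
    MemLp p 2 (stdGaussian (E n)) := by
  induction hp using Submodule.span_induction with
  | mem p hp =>
    obtain ⟨l, rfl⟩ := hp
    exact memLp_hermiteMulti l
  | zero => exact MemLp.zero'
  | add p q _ _ hp hq => exact hp.add hq
  | smul c p _ hp => exact hp.const_smul c

lemma integral_mul_eq_zero_of_mem_hermiteSpan {n : ℕ} {f : E n → ℝ}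
    (hf : MemLp f 2 (stdGaussian (E n)))
    (h : ∀ l, ∫ x, f x * hermiteMulti l x ∂(stdGaussian (E n)) = 0)
    {p : E n → ℝ} (hp : p ∈ hermiteSpan n) : ∫ x, f x * p x ∂(stdGaussian (E n)) = 0 := by
  induction hp using Submodule.span_induction with
  | mem p hp =>
    obtain ⟨l, rfl⟩ := hp
    exact h l
  | zero => simp
  | add p q hp hq hp' hq' =>
    simp only [Pi.add_apply, mul_add]
    have h1 : Integrable (fun x ↦ f x * p x) (stdGaussian (E n)) :=
      hf.integrable_mul (memLp_of_mem_hermiteSpan hp)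
    have h2 : Integrable (fun x ↦ f x * q x) (stdGaussian (E n)) :=
      hf.integrable_mul (memLp_of_mem_hermiteSpan hq)
    rw [integral_add h1 h2, hp', hq', add_zero]
  | smul c p _ hp =>
    simp only [Pi.smul_apply, smul_eq_mul, mul_left_comm _ c]
    rw [integral_const_mul, hp, mul_zero]

/-- A function with vanishing Fourier transform vanishes almost everywhere. -/
lemma ae_eq_zero_of_integral_exp_eq_zero {V : Type*} [NormedAddCommGroup V]
    [InnerProductSpace ℝ V] [CompleteSpace V] [SecondCountableTopology V] [MeasurableSpace V]
    [BorelSpace V] {ν : Measure V} [IsFiniteMeasure ν] {f : V → ℝ} (hf : Integrable f ν)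
    (h : ∀ t : V, ∫ x, (f x : ℂ) * Complex.exp (⟪x, t⟫ * Complex.I) ∂ν = 0) : f =ᵐ[ν] 0 := by
  have hfin {g : V → ℝ} (hg : Integrable g ν) :
      IsFiniteMeasure (ν.withDensity fun x ↦ ENNReal.ofReal (g x)) :=
    isFiniteMeasure_withDensity_ofReal hg.2
  have hexp (t : V) (g : V → ℝ) (hg : Integrable g ν) :
      Integrable (fun x ↦ (g x : ℂ) * Complex.exp (⟪x, t⟫ * Complex.I)) ν := by
    refine hg.ofReal.mul_bdd (c := 1) (by fun_prop) (ae_of_all _ fun x ↦ ?_)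
    rw [Complex.norm_exp_ofReal_mul_I]
  have hchar {g : V → ℝ} (hg : Integrable g ν) (t : V) :
      charFun (ν.withDensity fun x ↦ ENNReal.ofReal (g x)) t =
        ∫ x, ((max (g x) 0 : ℝ) : ℂ) * Complex.exp (⟪x, t⟫ * Complex.I) ∂ν := by
    rw [charFun_apply, integral_withDensity_eq_integral_toReal_smul₀
      (by have := hg.aemeasurable; fun_prop) (by simp)]
    simp [ENNReal.toReal_ofReal', Complex.real_smul]
  have := hfin hf
  have := hfin hf.neg
  -- The positive and negative parts of `f` are densities of two finite measures with the same
  -- characteristic function.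
  have heq : (ν.withDensity fun x ↦ ENNReal.ofReal (f x)) =
      ν.withDensity fun x ↦ ENNReal.ofReal ((-f) x) := by
    refine Measure.ext_of_charFun ?_
    ext t
    rw [hchar hf, hchar hf.neg, ← sub_eq_zero,
      ← integral_sub (hexp t _ hf.pos_part) (hexp t _ hf.neg.pos_part), ← h t]
    congr 1 with x
    rw [← sub_mul, ← Complex.ofReal_sub]
    congr 2
    simp only [Pi.neg_apply]
    rcases le_total (f x) 0 with hx | hx
    · rw [max_eq_right hx, max_eq_left (by linarith)]; ring
    · rw [max_eq_left hx, max_eq_right (by linarith)]; ring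
  rw [withDensity_eq_iff (by have := hf.aemeasurable; fun_prop)
    (by have := hf.aemeasurable; fun_prop) (by exact hf.lintegral_lt_top.ne)] at heq
  filter_upwards [heq] with x hx
  simp only [Pi.neg_apply] at hx
  rcases le_total (f x) 0 with h0 | h0
  · rw [ENNReal.ofReal_of_nonpos h0] at hx
    have := ENNReal.ofReal_eq_zero.1 hx.symm
    simp only [Pi.zero_apply]; linarith
  · rw [ENNReal.ofReal_of_nonpos (p := -f x) (by linarith)] at hx
    have := ENNReal.ofReal_eq_zero.1 hx
    simp only [Pi.zero_apply]; linarith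

/-- Since `exp(2|u|) ≤ exp(2u) + exp(-2u)`, Gaussian exponential moments suffice. This is the
dominating factor for the series of `exp(i⟨x, t⟩)`. -/
lemma memLp_exp_abs_inner {n : ℕ} (t : E n) :
    MemLp (fun x ↦ Real.exp |⟪t, x⟫|) 2 (stdGaussian (E n)) := by
  rw [memLp_two_iff_integrable_sq (by fun_prop)]
  have hint (c : ℝ) : Integrable (fun x ↦ Real.exp (c * ⟪t, x⟫)) (stdGaussian (E n)) := by
    have h : (stdGaussian (E n)).map (innerSL ℝ t) = _ :=
      IsGaussian.map_eq_gaussianReal (innerSL ℝ t)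
    have h2 := integrable_exp_mul_gaussianReal (μ := (stdGaussian (E n))[innerSL ℝ t])
      (v := Var[innerSL ℝ t; stdGaussian (E n)].toNNReal) c
    rw [← h, integrable_map_measure (by fun_prop) (by fun_prop)] at h2
    exact h2
  refine ((hint 2).add (hint (-2))).mono' (by fun_prop) (ae_of_all _ fun x ↦ ?_)
  simp only [Pi.add_apply]
  rw [← Real.exp_nat_mul, Real.norm_of_nonneg (Real.exp_pos _).le]
  have h1 := Real.exp_pos (2 * ⟪t, x⟫)
  have h2 := Real.exp_pos (-2 * ⟪t, x⟫)
  push_cast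
  rcases abs_cases ⟪t, x⟫ with ⟨h, _⟩ | ⟨h, _⟩ <;> rw [h]
  · linarith
  · rw [mul_neg, ← neg_mul]; linarith

/-- The Hermite polynomials are complete in `L²(N(0, id))`. -/
theorem ae_eq_zero_of_forall_integral_hermiteMulti_eq_zero {n : ℕ} {f : E n → ℝ}
    (hf : MemLp f 2 (stdGaussian (E n)))
    (h : ∀ l, ∫ x, f x * hermiteMulti l x ∂(stdGaussian (E n)) = 0) :
    f =ᵐ[stdGaussian (E n)] 0 := by
  refine ae_eq_zero_of_integral_exp_eq_zero (hf.integrable one_le_two) fun t ↦ ?_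
  -- The Fourier integral is expanded in powers of `⟨x, t⟩`; each term vanishes because `f` is
  -- orthogonal to all polynomials in the Hermite span.
  have hsum := hasSum_integral_of_dominated_convergence (μ := stdGaussian (E n))
    (F := fun k x ↦ (f x : ℂ) * ((⟪x, t⟫ * Complex.I) ^ k / k !))
    (f := fun x ↦ (f x : ℂ) * Complex.exp (⟪x, t⟫ * Complex.I))
    (fun k x ↦ |f x| * (|⟪t, x⟫| ^ k / k !))
    (fun k ↦ (Complex.continuous_ofReal.comp_aestronglyMeasurable hf.1).mul
      (by fun_prop))
    (fun k ↦ ae_of_all _ fun x ↦ by simp [real_inner_comm])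
    (ae_of_all _ fun x ↦ (Real.summable_pow_div_factorial _).mul_left _) ?_
    (ae_of_all _ fun x ↦ (by
      have := NormedSpace.expSeries_div_hasSum_exp (𝔸 := ℂ) (⟪x, t⟫ * Complex.I)
      rw [← Complex.exp_eq_exp_ℂ] at this
      exact this.mul_left _))
  · have hzero (k : ℕ) : ∫ x, (f x : ℂ) * ((⟪x, t⟫ * Complex.I) ^ k / k !)
        ∂(stdGaussian (E n)) = 0 := by
      have h0 := integral_mul_eq_zero_of_mem_hermiteSpan hf h (inner_pow_mem_hermiteSpan t k)
      have (x : E n) : (f x : ℂ) * ((⟪x, t⟫ * Complex.I) ^ k / k !) =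
          (Complex.I ^ k / k !) * ((f x * ⟪t, x⟫ ^ k : ℝ) : ℂ) := by
        rw [real_inner_comm t x]; push_cast; ring
      simp_rw [this]
      rw [integral_const_mul, integral_complex_ofReal, h0]
      simp
    simp_rw [hzero] at hsum
    exact hsum.unique hasSum_zero
  · have (x : E n) : ∑' k, |f x| * (|⟪t, x⟫| ^ k / k !) = |f x| * Real.exp |⟪t, x⟫| := by
      rw [tsum_mul_left, Real.exp_eq_exp_ℝ, NormedSpace.exp_eq_tsum_div]
    simp_rw [this]
    exact hf.abs.integrable_mul (memLp_exp_abs_inner t)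

/-! ### The Ornstein-Uhlenbeck semigroup -/

lemma eLpNorm_two_sq {α V : Type*} {_ : MeasurableSpace α} [NormedAddCommGroup V]
    (f : α → V) (ν : Measure α) : eLpNorm f 2 ν ^ 2 = ∫⁻ x, ‖f x‖ₑ ^ 2 ∂ν := by
  have h := eLpNorm_nnreal_pow_eq_lintegral (μ := ν) (f := f) (p := 2) (by norm_num)
  simpa using h

/-- Jensen's inequality. Measurability need not be assumed, as the Bochner integral of a
non-measurable function is zero. -/
lemma enorm_integral_sq_le {α : Type*} {_ : MeasurableSpace α} (ν : Measure α)
    [IsProbabilityMeasure ν] (f : α → ℝ) : ‖∫ x, f x ∂ν‖ₑ ^ 2 ≤ ∫⁻ x, ‖f x‖ₑ ^ 2 ∂ν := by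
  by_cases hf : AEStronglyMeasurable f ν
  · rw [← eLpNorm_two_sq]
    gcongr
    calc ‖∫ x, f x ∂ν‖ₑ ≤ ∫⁻ x, ‖f x‖ₑ ∂ν := enorm_integral_le_lintegral_enorm f
      _ = eLpNorm f 1 ν := by rw [eLpNorm_one_eq_lintegral_enorm]
      _ ≤ eLpNorm f 2 ν := eLpNorm_le_eLpNorm_of_exponent_le one_le_two hf
  · rw [integral_non_aestronglyMeasurable hf]
    simp

/-- The Ornstein-Uhlenbeck operator `f ↦ ∫ f(r x + s y) N(0, id)(dy)`, for `r² + s² = 1`. -/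
def ouOperator {n : ℕ} (r s : ℝ) (f : E n → ℝ) (x : E n) : ℝ :=
  ∫ y, f (r • x + s • y) ∂(stdGaussian (E n))

lemma exists_cos_sin {r s : ℝ} (hrs : r ^ 2 + s ^ 2 = 1) : ∃ θ, Real.cos θ = r ∧ Real.sin θ = s := by
  set z : ℂ := ⟨r, s⟩ with hz
  have hn : ‖z‖ = 1 := by
    rw [Complex.norm_def, Complex.normSq_mk]
    rw [← sq, ← sq, hrs, Real.sqrt_one]
  have h0 : z ≠ 0 := by
    intro h; simp [h] at hn
  exact ⟨Complex.arg z, by rw [Complex.cos_arg h0, hn]; simp [hz],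
    by rw [Complex.sin_arg, hn]; simp [hz]⟩

/-- A rotation followed by a sign change in the second component, both of which preserve the
Gaussian. The sign makes the map an involution, so it can be undone by applying it again. -/
lemma measurePreserving_rotation {n : ℕ} {r s : ℝ} (hrs : r ^ 2 + s ^ 2 = 1) :
    MeasurePreserving (fun p : E n × E n ↦ (r • p.1 + s • p.2, s • p.1 - r • p.2))
      ((stdGaussian (E n)).prod (stdGaussian (E n)))
      ((stdGaussian (E n)).prod (stdGaussian (E n))) := by
  obtain ⟨θ, rfl, rfl⟩ := exists_cos_sin hrs
  have h1 : MeasurePreserving (ContinuousLinearMap.rotation (E := E n) θ)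
      ((stdGaussian (E n)).prod (stdGaussian (E n)))
      ((stdGaussian (E n)).prod (stdGaussian (E n))) :=
    ⟨by fun_prop, IsGaussian.map_rotation_eq_self_of_forall_strongDual_eq_zero
      (fun L ↦ integral_strongDual_stdGaussian L) θ⟩
  have h2 : MeasurePreserving (fun x : E n ↦ -x) (stdGaussian (E n)) (stdGaussian (E n)) :=
    ⟨by fun_prop, stdGaussian_map (LinearIsometryEquiv.neg ℝ)⟩
  have h3 := ((MeasurePreserving.id (stdGaussian (E n))).prod h2).comp h1
  convert h3 using 1
  ext p <;> simp [ContinuousLinearMap.rotation_apply]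
  ring

lemma measurePreserving_smul_add_smul {n : ℕ} {r s : ℝ} (hrs : r ^ 2 + s ^ 2 = 1) :
    MeasurePreserving (fun p : E n × E n ↦ r • p.1 + s • p.2)
      ((stdGaussian (E n)).prod (stdGaussian (E n))) (stdGaussian (E n)) :=
  measurePreserving_fst.comp (measurePreserving_rotation hrs)

section

variable {n : ℕ} {r s : ℝ} {f : E n → ℝ}

lemma memLp_comp_smul_add_smul (hrs : r ^ 2 + s ^ 2 = 1) (hf : MemLp f 2 (stdGaussian (E n))) :
    MemLp (fun p : E n × E n ↦ f (r • p.1 + s • p.2)) 2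
      ((stdGaussian (E n)).prod (stdGaussian (E n))) :=
  hf.comp_measurePreserving (measurePreserving_smul_add_smul hrs)

lemma memLp_ouOperator (hrs : r ^ 2 + s ^ 2 = 1) (hf : MemLp f 2 (stdGaussian (E n))) :
    MemLp (ouOperator r s f) 2 (stdGaussian (E n)) := by
  have h := memLp_comp_smul_add_smul hrs hf
  refine ⟨h.1.integral_prod_right', ?_⟩
  have h2 : eLpNorm (ouOperator r s f) 2 (stdGaussian (E n)) ^ 2 ≤ 
      eLpNorm (fun p : E n × E n ↦ f (r • p.1 + s • p.2)) 2
      ((stdGaussian (E n)).prod (stdGaussian (E n))) ^ 2 := by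
    rw [eLpNorm_two_sq, eLpNorm_two_sq, lintegral_prod _ (h.1.enorm.pow_const 2)]
    exact lintegral_mono fun x ↦ enorm_integral_sq_le _ _
  have h3 := h.2
  refine lt_of_le_of_lt ?_ h3
  exact (ENNReal.pow_le_pow_left_iff two_ne_zero).1 h2

/-- The operator is symmetric, and `hermiteMulti l` is an eigenfunction, so it acts diagonally on
Hermite coefficients. -/
lemma integral_ouOperator_mul (hrs : r ^ 2 + s ^ 2 = 1) (hf : MemLp f 2 (stdGaussian (E n)))
    (l : Fin n → ℕ) :
    ∫ x, ouOperator r s f x * hermiteMulti l x ∂(stdGaussian (E n)) =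
      r ^ (∑ i, l i) * ∫ x, f x * hermiteMulti l x ∂(stdGaussian (E n)) := by
  set γ := stdGaussian (E n)
  have h := memLp_comp_smul_add_smul hrs hf
  have hl : MemLp (fun p : E n × E n ↦ hermiteMulti l p.1) 2 (γ.prod γ) :=
    (memLp_hermiteMulti l).comp_measurePreserving measurePreserving_fst
  have hl' : MemLp (fun p : E n × E n ↦ hermiteMulti l (r • p.1 + s • p.2)) 2 (γ.prod γ) :=
    memLp_comp_smul_add_smul hrs (memLp_hermiteMulti l)
  have hf' : MemLp (fun p : E n × E n ↦ f p.1) 2 (γ.prod γ) :=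
    hf.comp_measurePreserving measurePreserving_fst
  calc ∫ x, ouOperator r s f x * hermiteMulti l x ∂γ
      = ∫ x, ∫ y, f (r • x + s • y) * hermiteMulti l x ∂γ ∂γ := by
        simp_rw [integral_mul_const]; rfl
    _ = ∫ p : E n × E n, f (r • p.1 + s • p.2) * hermiteMulti l p.1 ∂(γ.prod γ) :=
        (integral_prod _ (h.integrable_mul hl)).symm
    -- The involution exchanges `p.1` with `r • p.1 + s • p.2`, which moves the averaging from `f`
    -- to the polynomial.
    _ = ∫ p : E n × E n, f p.1 * hermiteMulti l (r • p.1 + s • p.2) ∂(γ.prod γ) := by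
        have hm := measurePreserving_rotation (n := n) hrs
        conv_rhs => rw [← hm.map_eq]
        rw [integral_map hm.aemeasurable]
        · congr 1 with p
          congr 2
          simp only [smul_add, smul_sub, smul_smul]
          have : p.1 = (r ^ 2 + s ^ 2) • p.1 := by rw [hrs, one_smul]
          nth_rw 1 [this]
          module
        · rw [hm.map_eq]
          exact (hf'.integrable_mul hl').1
    _ = ∫ x, ∫ y, f x * hermiteMulti l (r • x + s • y) ∂γ ∂γ :=
        integral_prod _ (hf'.integrable_mul hl')
    _ = _ := by
        simp_rw [integral_const_mul]
        rw [← integral_const_mul]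
        congr 1 with x
        rw [integral_hermiteMulti_comp l hrs]
        ring

/-- The normalized Hermite polynomials, as elements of `L²(N(0, id))`. -/
def hermiteLp (l : Fin n → ℕ) : Lp ℝ 2 (stdGaussian (E n)) :=
  (√(∏ i, ((l i)! : ℝ)))⁻¹ • (memLp_hermiteMulti l).toLp

lemma inner_hermiteLp (l : Fin n → ℕ) (hf : MemLp f 2 (stdGaussian (E n))) :
    ⟪hermiteLp l, hf.toLp⟫ =
      (√(∏ i, ((l i)! : ℝ)))⁻¹ * ∫ x, f x * hermiteMulti l x ∂(stdGaussian (E n)) := by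
  rw [hermiteLp, real_inner_smul_left, L2.inner_def]
  congr 1
  refine integral_congr_ae ?_
  filter_upwards [hf.coeFn_toLp, (memLp_hermiteMulti l).coeFn_toLp] with x h1 h2
  rw [h1, h2]
  simp

lemma orthonormal_hermiteLp : Orthonormal ℝ (hermiteLp (n := n)) := by
  rw [orthonormal_iff_ite]
  intro k l
  have h0 : 0 < ∏ i, ((l i)! : ℝ) := Finset.prod_pos fun i _ ↦ by positivity
  conv_lhs => rw [hermiteLp.eq_def l]
  rw [real_inner_smul_right, inner_hermiteLp, integral_hermiteMulti_mul]
  by_cases h : k = l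
  · subst h
    simp only [if_true]
    have := Real.mul_self_sqrt h0.le
    have h1 := Real.sqrt_pos.2 h0
    field_simp
    rw [sq, this]
  · simp [h, Ne.symm h]

/-- The Hilbert basis of `L²(N(0, id))` which consists of the normalized Hermite polynomials. -/
def hermiteBasis : HilbertBasis (Fin n → ℕ) ℝ (Lp ℝ 2 (stdGaussian (E n))) :=
  HilbertBasis.mkOfOrthogonalEqBot orthonormal_hermiteLp (by
    rw [Submodule.eq_bot_iff]
    intro g hg
    have hmem := Lp.memLp g
    have hzero := ae_eq_zero_of_forall_integral_hermiteMulti_eq_zero hmem fun l ↦ by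
      have h1 := (Submodule.mem_orthogonal _ _).1 hg _ (Submodule.subset_span ⟨l, rfl⟩)
      have h2 := inner_hermiteLp l hmem
      rw [Lp.toLp_coeFn, h1] at h2
      have h0 : 0 < ∏ i, ((l i)! : ℝ) := Finset.prod_pos fun i _ ↦ by positivity
      have h3 := (inv_pos.2 (Real.sqrt_pos.2 h0)).ne'
      exact (mul_eq_zero.1 h2.symm).resolve_left h3
    exact (Lp.eq_zero_iff_ae_eq_zero).2 hzero)

@[simp] lemma hermiteBasis_apply (l : Fin n → ℕ) : hermiteBasis l = hermiteLp l := by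
  simp [hermiteBasis]

lemma hasSum_inner_hermiteLp_sq (g : Lp ℝ 2 (stdGaussian (E n))) :
    HasSum (fun l ↦ ⟪hermiteLp l, g⟫ ^ 2) (‖g‖ ^ 2) := by
  have h := hermiteBasis.hasSum_inner_mul_inner g g
  simp only [hermiteBasis_apply, real_inner_self_eq_norm_sq] at h
  refine h.congr_fun ?_
  intro l
  rw [real_inner_comm, sq]

/-- On functions which are orthogonal to the Hermite polynomials of degree less than `k`, the
Ornstein-Uhlenbeck operator has norm at most `r ^ k`. -/
theorem eLpNorm_ouOperator_le (hrs : r ^ 2 + s ^ 2 = 1) (hr : 0 ≤ r)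
    (hf : MemLp f 2 (stdGaussian (E n))) {k : ℕ}
    (hk : ∀ l : Fin n → ℕ, ∑ i, l i < k →
      ∫ x, f x * hermiteMulti l x ∂(stdGaussian (E n)) = 0) :
    eLpNorm (ouOperator r s f) 2 (stdGaussian (E n)) ≤
      ENNReal.ofReal (r ^ k) * eLpNorm f 2 (stdGaussian (E n)) := by
  have hT := memLp_ouOperator hrs hf
  have hr1 : r ≤ 1 := by nlinarith [sq_nonneg s]
  have h1 := hasSum_inner_hermiteLp_sq hT.toLp
  have h2 := (hasSum_inner_hermiteLp_sq hf.toLp).mul_left ((r ^ k) ^ 2)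
  have h3 : ‖hT.toLp‖ ^ 2 ≤ (r ^ k) ^ 2 * ‖hf.toLp‖ ^ 2 := by
    -- The two Parseval series are compared termwise: terms of degree below `k` vanish, and the
    -- others carry `r ^ |l| ≤ r ^ k`.
    refine hasSum_le (fun l ↦ ?_) h1 h2
    rw [inner_hermiteLp, inner_hermiteLp, integral_ouOperator_mul hrs hf]
    rcases lt_or_ge (∑ i, l i) k with hl | hl
    · simp [hk l hl]
    · rw [mul_left_comm, mul_pow]
      gcongr ?_ ^ 2 * _
      exact pow_le_pow_of_le_one hr hr1 hl
  have h4 : ‖hT.toLp‖ ≤ r ^ k * ‖hf.toLp‖ := by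
    rw [← mul_pow] at h3
    exact (pow_le_pow_iff_left₀ (norm_nonneg _) (by positivity) two_ne_zero).1 h3
  rw [Lp.norm_toLp, Lp.norm_toLp] at h4
  rw [← ENNReal.toReal_le_toReal hT.2.ne (ENNReal.mul_ne_top ENNReal.ofReal_ne_top hf.2.ne),
    ENNReal.toReal_mul, ENNReal.toReal_ofReal (by positivity)]
  exact h4

end

/-! ### Conditional expectations of functions of Gaussian vectors -/

section

variable {Ω : Type*} {m mΩ : MeasurableSpace Ω} {μ : Measure Ω}

/-- If `X` and `Y` are independent, then `E[f(X, Y) | X]` is obtained by integrating over the law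
of `Y`. -/
lemma condExp_prod_ae_eq_integral_map [IsProbabilityMeasure μ] {α V : Type*}
    {mα : MeasurableSpace α} [MeasurableSpace V] [StandardBorelSpace V] [Nonempty V]
    {X : Ω → α} {Y : Ω → V} (hX : Measurable X) (hY : Measurable Y)
    (hind : Indep (MeasurableSpace.comap X mα) (MeasurableSpace.comap Y inferInstance) μ)
    {f : α × V → ℝ} (hf : StronglyMeasurable f) (hint : Integrable (fun ω ↦ f (X ω, Y ω)) μ) :
    μ[fun ω ↦ f (X ω, Y ω) | MeasurableSpace.comap X mα] =ᵐ[μ]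
      fun ω ↦ ∫ y, f (X ω, y) ∂(μ.map Y) := by
  have : IsProbabilityMeasure (μ.map Y) := Measure.isProbabilityMeasure_map hY.aemeasurable
  have h1 := condExp_prod_ae_eq_integral_condDistrib hX hY.aemeasurable hf hint
  -- By independence the joint law is a product, so the conditional distribution is constant.
  have h2 : condDistrib Y X μ =ᵐ[μ.map X] Kernel.const α (μ.map Y) := by
    refine condDistrib_ae_eq_of_measure_eq_compProd X hY.aemeasurable ?_
    rw [Measure.compProd_const]
    exact (indepFun_iff_map_prod_eq_prod_map_map hX.aemeasurable hY.aemeasurable).1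
      ((IndepFun_iff_Indep _ _ _).2 hind)
  refine h1.trans ?_
  filter_upwards [ae_of_ae_map hX.aemeasurable h2] with ω hω
  rw [hω, Kernel.const_apply]

/-- If `a` is `m`-measurable and `b` is independent of `m`, then `E[F(a + b) | m]` is obtained by
integrating over the law of `b`. -/
lemma condExp_comp_add_ae_eq [IsProbabilityMeasure μ] {V : Type*} [NormedAddCommGroup V]
    [MeasurableSpace V] [BorelSpace V] [SecondCountableTopology V] [CompleteSpace V]
    (hm : m ≤ mΩ) {a b : Ω → V} (ha : Measurable[m] a) (hb : Measurable b)
    (hind : Indep m (MeasurableSpace.comap b inferInstance) μ) {F : V → ℝ}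
    (hF : StronglyMeasurable F) (hint : Integrable (fun ω ↦ F (a ω + b ω)) μ) :
    μ[fun ω ↦ F (a ω + b ω) | m] =ᵐ[μ] fun ω ↦ ∫ y, F (a ω + y) ∂(μ.map b) := by
  -- The conditioning variable is the identity, viewed as a map into `Ω` with the smaller σ-algebra
  -- `m`.
  have h := condExp_prod_ae_eq_integral_map (mα := m) (X := id) (Y := b) (μ := μ)
    (f := fun p ↦ F (a p.1 + p.2)) (measurable_id'' hm) hb
    (by rwa [MeasurableSpace.comap_id])
    (hF.comp_measurable ((ha.comp measurable_fst).add measurable_snd)) hint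
  rwa [MeasurableSpace.comap_id] at h

/-- The map `f ↦ ∫ f(· + y) κ(dy)` contracts `L²`-norms. -/
lemma lintegral_enorm_integral_conv_sq_le {V : Type*} [NormedAddCommGroup V] [MeasurableSpace V]
    [BorelSpace V] [SecondCountableTopology V] {α κ τ : Measure V} [IsProbabilityMeasure α]
    [IsProbabilityMeasure κ] [IsProbabilityMeasure τ] {F : V → ℝ} (hF : StronglyMeasurable F)
    (hint : Integrable F (α ∗ (κ ∗ τ))) :
    ∫⁻ x, ‖∫ y, F (x + y) ∂(κ ∗ τ)‖ₑ ^ 2 ∂α ≤ ∫⁻ u, ‖∫ z, F (u + z) ∂τ‖ₑ ^ 2 ∂(α ∗ κ) := by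
  have hmeas : StronglyMeasurable fun u ↦ ∫ z, F (u + z) ∂τ :=
    (hF.comp_measurable (measurable_fst.add measurable_snd)).integral_prod_right'
  rw [Measure.lintegral_conv (by fun_prop)]
  refine lintegral_mono_ae ?_
  filter_upwards [((integrable_conv_iff hF.aestronglyMeasurable).1 hint).1] with x hx
  rw [integral_conv hx]
  simp_rw [← add_assoc]
  exact enorm_integral_sq_le κ _

/-- The matrix of second moments of a random vector. -/
def momentMatrix {n : ℕ} (μ : Measure Ω) (a : Ω → E n) : Matrix (Fin n) (Fin n) ℝ :=
  Matrix.of fun i j ↦ ∫ ω, a ω i * a ω j ∂μ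

lemma dotProduct_momentMatrix_mulVec {n : ℕ} {a : Ω → E n} (ha : MemLp a 2 μ) (x : E n) :
    x ⬝ᵥ momentMatrix μ a *ᵥ x = ∫ ω, ⟪x, a ω⟫ ^ 2 ∂μ := by
  have hi (i : Fin n) : MemLp (fun ω ↦ a ω i) 2 μ :=
    (EuclideanSpace.proj (𝕜 := ℝ) i).comp_memLp' ha
  have hij (i j : Fin n) : Integrable (fun ω ↦ x i * (a ω i * a ω j * x j)) μ :=
    (((hi i).integrable_mul (hi j)).mul_const _).const_mul _
  have h (ω : Ω) : ⟪x, a ω⟫ ^ 2 = ∑ i, ∑ j, x i * (a ω i * a ω j * x j) := by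
    rw [PiLp.inner_apply, sq, Finset.sum_mul_sum]
    simp only [RCLike.inner_apply, conj_trivial]
    exact Finset.sum_congr rfl fun i _ ↦ Finset.sum_congr rfl fun j _ ↦ by ring
  simp_rw [h]
  rw [integral_finsetSum _ fun i _ ↦ integrable_finsetSum _ fun j _ ↦ hij i j]
  simp_rw [integral_finsetSum _ fun j _ ↦ hij _ j]
  simp only [dotProduct, Matrix.mulVec, momentMatrix, Matrix.of_apply, Finset.mul_sum,
    integral_const_mul, integral_mul_const]

lemma momentMatrix_isHermitian {n : ℕ} (a : Ω → E n) : (momentMatrix μ a).IsHermitian := by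
  ext i j
  simp [momentMatrix, mul_comm]

lemma posSemidef_momentMatrix {n : ℕ} {a : Ω → E n} (ha : MemLp a 2 μ) :
    (momentMatrix μ a).PosSemidef := by
  refine .of_dotProduct_mulVec_nonneg (momentMatrix_isHermitian a) fun x ↦ ?_
  have h := dotProduct_momentMatrix_mulVec ha (WithLp.toLp 2 x)
  simp only [star_trivial]
  rw [h]
  exact integral_nonneg fun ω ↦ sq_nonneg _

/-- If the second moments of `a` are dominated by `c id`, there is a centered Gaussian measure whose
covariance is the difference. -/
lemma exists_gaussian_complement {n : ℕ} {a : Ω → E n} (ha : MemLp a 2 μ) {c : ℝ}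
    (hc : ∀ x, ∫ ω, ⟪x, a ω⟫ ^ 2 ∂μ ≤ c * ‖x‖ ^ 2) :
    ∃ κ : Measure (E n), IsProbabilityMeasure κ ∧ ∀ x, charFun κ x =
      Complex.exp (-((c * ‖x‖ ^ 2 - ∫ ω, ⟪x, a ω⟫ ^ 2 ∂μ : ℝ) : ℂ) / 2) := by
  have hq (x : E n) : x ⬝ᵥ (c • (1 : Matrix (Fin n) (Fin n) ℝ) - momentMatrix μ a) *ᵥ x =
      c * ‖x‖ ^ 2 - ∫ ω, ⟪x, a ω⟫ ^ 2 ∂μ := by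
    rw [Matrix.sub_mulVec, dotProduct_sub, dotProduct_momentMatrix_mulVec ha, Matrix.smul_mulVec,
      Matrix.one_mulVec, dotProduct_smul, EuclideanSpace.real_norm_sq_eq]
    simp [dotProduct, sq]
  have hpos : (c • (1 : Matrix (Fin n) (Fin n) ℝ) - momentMatrix μ a).PosSemidef := by
    refine .of_dotProduct_mulVec_nonneg ?_ fun x ↦ ?_
    · refine Matrix.IsHermitian.sub ?_ (momentMatrix_isHermitian a)
      ext i j
      simp [Matrix.one_apply, eq_comm]
    · have h := hq (WithLp.toLp 2 x)
      simp only [star_trivial]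
      rw [h]
      linarith [hc (WithLp.toLp 2 x)]
  refine ⟨multivariateGaussian 0 (c • (1 : Matrix (Fin n) (Fin n) ℝ) - momentMatrix μ a),
    inferInstance, fun x ↦ ?_⟩
  rw [charFun_multivariateGaussian hpos, hq]
  simp only [inner_zero_right, Complex.ofReal_zero, zero_mul, zero_sub, neg_div]

/-- Let `a` be `m`-measurable and let `b` be independent of `m`, such that both are centered Gaussian
and `a + b` is standard Gaussian. If the covariance of `a` is dominated by `c id`, and if `F` is
orthogonal to the Hermite polynomials of degree less than `k`, then the conditional expectation
given `m` contracts the `L²`-norm of `F(a + b)` by the factor `√c ^ k`. -/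
theorem eLpNorm_condExp_comp_add_le [IsProbabilityMeasure μ] {n : ℕ} (hm : m ≤ mΩ) {a b : Ω → E n}
    (ha : Measurable[m] a) (hb : Measurable b)
    (hind : Indep m (MeasurableSpace.comap b inferInstance) μ)
    (ha2 : MemLp a 2 μ)
    (hga : ∀ x, charFun (μ.map a) x = Complex.exp (-(∫ ω, ⟪x, a ω⟫ ^ 2 ∂μ : ℝ) / 2))
    (hgb : ∀ x, charFun (μ.map b) x = Complex.exp (-(∫ ω, ⟪x, b ω⟫ ^ 2 ∂μ : ℝ) / 2))
    (hab : ∀ x, ∫ ω, ⟪x, a ω⟫ ^ 2 ∂μ + ∫ ω, ⟪x, b ω⟫ ^ 2 ∂μ = ‖x‖ ^ 2)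
    {c : ℝ} (hc0 : 0 ≤ c) (hc1 : c ≤ 1) (hc : ∀ x, ∫ ω, ⟪x, a ω⟫ ^ 2 ∂μ ≤ c * ‖x‖ ^ 2)
    {F : E n → ℝ} (hF : MemLp F 2 (stdGaussian (E n))) {k : ℕ}
    (hk : ∀ l : Fin n → ℕ, ∑ i, l i < k →
      ∫ x, F x * hermiteMulti l x ∂(stdGaussian (E n)) = 0) :
    eLpNorm (μ[fun ω ↦ F (a ω + b ω) | m]) 2 μ ≤
      ENNReal.ofReal (√c ^ k) * eLpNorm F 2 (stdGaussian (E n)) := by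
  have ha' : Measurable a := ha.mono hm le_rfl
  have hpa : IsProbabilityMeasure (μ.map a) := Measure.isProbabilityMeasure_map ha'.aemeasurable
  have hpb : IsProbabilityMeasure (μ.map b) := Measure.isProbabilityMeasure_map hb.aemeasurable
  obtain ⟨κ, hκ, hκc⟩ := exists_gaussian_complement ha2 hc
  set r := √c with hr
  set s := √(1 - c) with hs
  have hr2 : r ^ 2 = c := Real.sq_sqrt hc0
  have hs2 : s ^ 2 = 1 - c := Real.sq_sqrt (by linarith)
  have hrs : r ^ 2 + s ^ 2 = 1 := by rw [hr2, hs2]; ring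
  set γ := stdGaussian (E n)
  have hscale (t : ℝ) : IsProbabilityMeasure (γ.map fun x ↦ t • x) :=
    Measure.isProbabilityMeasure_map (by fun_prop)
  have hγc (t : ℝ) (x : E n) : charFun (γ.map fun x ↦ t • x) x =
      Complex.exp (-((t ^ 2 * ‖x‖ ^ 2 : ℝ) : ℂ) / 2) := by
    rw [charFun_map_smul, charFun_stdGaussian, norm_smul]
    congr 1
    rw [Real.norm_eq_abs]
    push_cast
    rw [mul_pow, ← Complex.ofReal_pow |t|, sq_abs]
    push_cast
    ring
  -- The noise `b` contains the missing covariance `c id - Cov(a)` plus the isotropic part `(1 - c)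
  -- id`. Shifting `κ` over to `a` leaves `N(0, c id)` there.
  have hb_eq : μ.map b = κ ∗ (γ.map fun x ↦ s • x) := by
    refine Measure.ext_of_charFun ?_
    ext x
    rw [charFun_conv, hgb, hκc, hγc, ← Complex.exp_add, hs2]
    congr 1
    have : ∫ ω, ⟪x, b ω⟫ ^ 2 ∂μ = ‖x‖ ^ 2 - ∫ ω, ⟪x, a ω⟫ ^ 2 ∂μ := by linarith [hab x]
    rw [this]
    push_cast
    ring
  have hκ_eq : μ.map a ∗ κ = γ.map fun x ↦ r • x := by
    refine Measure.ext_of_charFun ?_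
    ext x
    rw [charFun_conv, hga, hκc, hγc, ← Complex.exp_add, hr2]
    congr 1
    push_cast
    ring
  have hsum : μ.map a ∗ μ.map b = γ := by
    refine Measure.ext_of_charFun ?_
    ext x
    rw [charFun_conv, hga, hgb, charFun_stdGaussian, ← Complex.exp_add]
    congr 1
    rw [← Complex.ofReal_pow, ← hab x]
    push_cast
    ring
  have hindf : IndepFun a b μ := by
    rw [IndepFun_iff_Indep]
    exact indep_of_indep_of_le_left hind (measurable_iff_comap_le.1 ha)
  have hmap : μ.map (fun ω ↦ a ω + b ω) = γ := by
    rw [← hsum]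
    exact hindf.map_add_eq_map_conv_map ha' hb
  have hmp : MeasurePreserving (fun ω ↦ a ω + b ω) μ γ := ⟨by fun_prop, hmap⟩
  -- reduction to a strongly measurable function
  wlog hFm : StronglyMeasurable F generalizing F
  · have hae := hF.1.ae_eq_mk
    have hF' : MemLp (hF.1.mk F) 2 γ := (memLp_congr_ae hae).1 hF
    have h := this hF' (fun l hl ↦ by
      rw [← hk l hl]
      refine integral_congr_ae ?_
      filter_upwards [hae] with x hx
      rw [hx]) hF.1.stronglyMeasurable_mk
    rw [← eLpNorm_congr_ae hae] at h
    refine le_trans (le_of_eq (eLpNorm_congr_ae (condExp_congr_ae ?_))) h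
    exact hmp.quasiMeasurePreserving.ae_eq_comp hae
  have hint : Integrable F γ := hF.integrable one_le_two
  -- It remains to compare the conditional expectation with the Ornstein-Uhlenbeck average, by
  -- Jensen with respect to `κ`.
  refine le_trans ?_ (eLpNorm_ouOperator_le hrs (Real.sqrt_nonneg c) hF hk)
  have hcond := condExp_comp_add_ae_eq hm ha hb hind hFm (hmp.integrable_comp_of_integrable hint)
  rw [eLpNorm_congr_ae hcond, ← ENNReal.pow_le_pow_left_iff two_ne_zero, eLpNorm_two_sq,
    eLpNorm_two_sq]
  have hm1 : StronglyMeasurable fun u ↦ ∫ y, F (u + y) ∂(μ.map b) :=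
    (hFm.comp_measurable (measurable_fst.add measurable_snd)).integral_prod_right'
  have hm2 : StronglyMeasurable fun u ↦ ∫ y, F (u + y) ∂(γ.map fun x ↦ s • x) :=
    (hFm.comp_measurable (measurable_fst.add measurable_snd)).integral_prod_right'
  calc ∫⁻ ω, ‖∫ y, F (a ω + y) ∂(μ.map b)‖ₑ ^ 2 ∂μ
      = ∫⁻ x, ‖∫ y, F (x + y) ∂(μ.map b)‖ₑ ^ 2 ∂(μ.map a) := by
        rw [lintegral_map (by fun_prop) ha']
    _ ≤ ∫⁻ u, ‖∫ z, F (u + z) ∂(γ.map fun x ↦ s • x)‖ₑ ^ 2 ∂(μ.map a ∗ κ) := by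
        rw [hb_eq]
        refine lintegral_enorm_integral_conv_sq_le hFm ?_
        rw [← hb_eq, hsum]
        exact hint
    _ = ∫⁻ x, ‖ouOperator r s F x‖ₑ ^ 2 ∂γ := by
        rw [hκ_eq, lintegral_map (by fun_prop) (by fun_prop)]
        congr 1 with x
        have hFx : StronglyMeasurable fun z ↦ F (r • x + z) := hFm.comp_measurable (by fun_prop)
        rw [integral_map (by fun_prop) hFx.aestronglyMeasurable]
        rfl

end

/-! ### The Gaussian space of a Wiener process -/

section

variable {Ω : Type*} {mΩ : MeasurableSpace Ω} {μ : Measure Ω}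

lemma tendsto_integral_inner_of_tendsto_eLpNorm {V : Type*} [NormedAddCommGroup V]
    [InnerProductSpace ℝ V] {X Y : Ω → V} {x y : ℕ → Ω → V}
    (hX : MemLp X 2 μ) (hY : MemLp Y 2 μ) (hx : ∀ k, MemLp (x k) 2 μ) (hy : ∀ k, MemLp (y k) 2 μ)
    (hxX : Tendsto (fun k ↦ eLpNorm (x k - X) 2 μ) atTop (𝓝 0))
    (hyY : Tendsto (fun k ↦ eLpNorm (y k - Y) 2 μ) atTop (𝓝 0)) :
    Tendsto (fun k ↦ ∫ ω, ⟪x k ω, y k ω⟫ ∂μ) atTop (𝓝 (∫ ω, ⟪X ω, Y ω⟫ ∂μ)) := by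
  have h (u w : Ω → V) (hu : MemLp u 2 μ) (hw : MemLp w 2 μ) :
      ∫ ω, ⟪u ω, w ω⟫ ∂μ = ⟪hu.toLp, hw.toLp⟫ := by
    rw [L2.inner_def]
    refine integral_congr_ae ?_
    filter_upwards [hu.coeFn_toLp, hw.coeFn_toLp] with ω h1 h2
    rw [h1, h2]
  simp_rw [h _ _ (hx _) (hy _), h _ _ hX hY]
  exact ((Lp.tendsto_Lp_iff_tendsto_eLpNorm'' x hx X hX).2 hxX).inner
    ((Lp.tendsto_Lp_iff_tendsto_eLpNorm'' y hy Y hY).2 hyY)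

/-- An `L²`-limit of centered Gaussian random variables is a centered Gaussian random variable. -/
lemma hasGaussianLaw_of_tendsto_eLpNorm [IsProbabilityMeasure μ] {X : Ω → ℝ} {x : ℕ → Ω → ℝ}
    (hX : MemLp X 2 μ) (hx : ∀ k, HasGaussianLaw (x k) μ) (hx0 : ∀ k, ∫ ω, x k ω ∂μ = 0)
    (hlim : Tendsto (fun k ↦ eLpNorm (x k - X) 2 μ) atTop (𝓝 0)) :
    HasGaussianLaw X μ ∧ ∫ ω, X ω ∂μ = 0 := by
  have hx2 (k : ℕ) : MemLp (x k) 2 μ := (hx k).memLp_two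
  have hXm : AEMeasurable X μ := hX.1.aemeasurable
  -- Along an almost surely convergent subsequence, characteristic functions converge by dominated
  -- convergence, while `L²`-convergence gives convergence of the variances; uniqueness of limits
  -- identifies the law.
  obtain ⟨ns, hns, hae⟩ := (tendstoInMeasure_of_tendsto_eLpNorm two_ne_zero
    (fun k ↦ (hx2 k).1) hX.1 hlim).exists_seq_tendsto_ae
  have hvar := (tendsto_integral_inner_of_tendsto_eLpNorm hX hX hx2 hx2 hlim hlim).comp
    hns.tendsto_atTop
  simp only [Function.comp_def, RCLike.inner_apply, conj_trivial, ← sq] at hvar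
  have hv0 : 0 ≤ ∫ ω, X ω ^ 2 ∂μ := integral_nonneg fun ω ↦ sq_nonneg _
  have hmap : μ.map X = gaussianReal 0 (∫ ω, X ω ^ 2 ∂μ).toNNReal := by
    have := Measure.isProbabilityMeasure_map hXm
    refine Measure.ext_of_charFun ?_
    ext t
    have h1 : Tendsto (fun k ↦ charFun (μ.map (x (ns k))) t) atTop (𝓝 (charFun (μ.map X) t)) := by
      simp_rw [charFun_apply]
      rw [integral_map hXm (by fun_prop)]
      have (k : ℕ) := integral_map (f := fun z : ℝ ↦ Complex.exp (⟪z, t⟫ * Complex.I))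
        (hx2 (ns k)).1.aemeasurable (by fun_prop)
      simp_rw [this]
      refine tendsto_integral_of_dominated_convergence (fun _ ↦ 1) (fun k ↦ ?_)
        (integrable_const _) (fun k ↦ ae_of_all _ fun ω ↦ ?_) ?_
      · have := (hx2 (ns k)).1
        fun_prop
      · rw [Complex.norm_exp_ofReal_mul_I]
      · filter_upwards [hae] with ω hω
        have hc : Continuous fun z : ℝ ↦ Complex.exp (⟪z, t⟫ * Complex.I) := by fun_prop
        exact (hc.tendsto _).comp hω
    have h2 : Tendsto (fun k ↦ charFun (μ.map (x (ns k))) t) atTop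
        (𝓝 (charFun (gaussianReal 0 (∫ ω, X ω ^ 2 ∂μ).toNNReal) t)) := by
      have hk (k : ℕ) : charFun (μ.map (x (ns k))) t =
          Complex.exp (-((∫ ω, x (ns k) ω ^ 2 ∂μ : ℝ) * t ^ 2 / 2)) := by
        rw [(hx (ns k)).map_eq_gaussianReal, charFun_gaussianReal, hx0,
          Real.coe_toNNReal _ (variance_nonneg _ _),
          variance_of_integral_eq_zero (hx2 _).1.aemeasurable (hx0 _)]
        simp
      simp_rw [hk]
      have hval : charFun (gaussianReal 0 (∫ ω, X ω ^ 2 ∂μ).toNNReal) t =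
          Complex.exp (-((∫ ω, X ω ^ 2 ∂μ : ℝ) * t ^ 2 / 2)) := by
        rw [charFun_gaussianReal, Real.coe_toNNReal _ hv0]
        simp
      rw [hval]
      have hc : Continuous fun z : ℝ ↦ Complex.exp (-((z : ℂ) * t ^ 2 / 2)) := by fun_prop
      exact (hc.tendsto _).comp hvar
    exact tendsto_nhds_unique h1 h2
  refine ⟨⟨by rw [hmap]; infer_instance⟩, ?_⟩
  have h := integral_map hXm (f := fun x : ℝ ↦ x) (by fun_prop)
  rw [← h, hmap, integral_id_gaussianReal]

variable {d : ℕ}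

/-- The linear span of the random variables `⟨w, W_t⟩`. -/
def wienerSpan (W : ℝ → Ω → E d) : Submodule ℝ (Ω → ℝ) :=
  Submodule.span ℝ (Set.range fun p : E d × ℝ ↦ fun ω ↦ ⟪p.1, W p.2 ω⟫)

/-- The `L²`-closure of the linear span of the random variables `⟨w, W_t⟩`. -/
def gaussianSpace (μ : Measure Ω) (W : ℝ → Ω → E d) : Submodule ℝ (Ω → ℝ) where
  carrier := {X | MemLp X 2 μ ∧ ∃ x : ℕ → Ω → ℝ, (∀ k, x k ∈ wienerSpan W ∧ MemLp (x k) 2 μ) ∧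
    Tendsto (fun k ↦ eLpNorm (x k - X) 2 μ) atTop (𝓝 0)}
  add_mem' := by
    rintro X Y ⟨hX, x, hx, hxX⟩ ⟨hY, y, hy, hyY⟩
    refine ⟨hX.add hY, fun k ↦ x k + y k,
      fun k ↦ ⟨Submodule.add_mem _ (hx k).1 (hy k).1, (hx k).2.add (hy k).2⟩, ?_⟩
    refine tendsto_of_tendsto_of_tendsto_of_le_of_le tendsto_const_nhds
      (by simpa using hxX.add hyY) (fun _ ↦ zero_le) fun k ↦ ?_
    have h : x k + y k - (X + Y) = (x k - X) + (y k - Y) := by abel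
    simp only [h]
    exact eLpNorm_add_le ((hx k).2.sub hX).1 ((hy k).2.sub hY).1 one_le_two
  zero_mem' := ⟨MemLp.zero', fun _ ↦ 0, fun _ ↦ ⟨Submodule.zero_mem _, MemLp.zero'⟩, by simp⟩
  smul_mem' := by
    rintro c X ⟨hX, x, hx, hxX⟩
    refine ⟨hX.const_smul c, fun k ↦ c • x k,
      fun k ↦ ⟨Submodule.smul_mem _ c (hx k).1, (hx k).2.const_smul c⟩, ?_⟩
    have h (k : ℕ) : eLpNorm (c • x k - c • X) 2 μ = ‖c‖ₑ * eLpNorm (x k - X) 2 μ := by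
      rw [← smul_sub, eLpNorm_const_smul]
    simp_rw [h]
    simpa using ENNReal.Tendsto.const_mul hxX (Or.inr (by simp))

lemma inner_sub_mem_wienerSpan (W : ℝ → Ω → E d) (w : E d) (s t : ℝ) :
    (fun ω ↦ ⟪w, W t ω - W s ω⟫) ∈ wienerSpan W := by
  have h : (fun ω ↦ ⟪w, W t ω - W s ω⟫) = (fun ω ↦ ⟪w, W t ω⟫) - fun ω ↦ ⟪w, W s ω⟫ := by
    ext ω
    simp [inner_sub_right]
  rw [h]
  exact Submodule.sub_mem _ (Submodule.subset_span ⟨(w, t), rfl⟩)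
    (Submodule.subset_span ⟨(w, s), rfl⟩)

/-- An element of the span involves finitely many times, so its Gaussianity follows from that of the
finite-dimensional distributions. -/
lemma exists_eq_comp_restrict_of_mem_wienerSpan {W : ℝ → Ω → E d} {X : Ω → ℝ}
    (hX : X ∈ wienerSpan W) : ∃ (I : Finset ℝ) (L : (I → E d) →L[ℝ] ℝ),
      ∀ ω, X ω = L (fun t ↦ W t ω) := by
  induction hX using Submodule.span_induction with
  | mem X hX =>
    obtain ⟨p, rfl⟩ := hX
    exact ⟨{p.2}, (innerSL ℝ p.1).comp
      (.proj (⟨p.2, Finset.mem_singleton_self _⟩ : ({p.2} : Finset ℝ))),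
      fun ω ↦ by simp⟩
  | zero => exact ⟨∅, 0, fun ω ↦ by simp⟩
  | add X Y _ _ hX hY =>
    obtain ⟨I, L, hL⟩ := hX
    obtain ⟨J, M, hM⟩ := hY
    classical
    refine ⟨I ∪ J,
      L.comp (ContinuousLinearMap.pi fun i ↦ .proj ⟨i.1, Finset.mem_union_left _ i.2⟩) +
      M.comp (ContinuousLinearMap.pi fun j ↦ .proj ⟨j.1, Finset.mem_union_right _ j.2⟩),
      fun ω ↦ ?_⟩
    simp only [Pi.add_apply, hL, hM]
    rfl
  | smul c X _ hX =>
    obtain ⟨I, L, hL⟩ := hX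
    exact ⟨I, c • L, fun ω ↦ by simp [hL]⟩

namespace IsWienerProcess

variable {W : ℝ → Ω → E d}

lemma hasGaussianLaw_sub (hW : IsWienerProcess μ W) {s t : ℝ} (hst : s ≤ t) :
    HasGaussianLaw (fun ω ↦ W t ω - W s ω) μ :=
  (hW.law s t hst).hasGaussianLaw

/-- The finite-dimensional distributions of a Wiener process are Gaussian. -/
lemma hasGaussianLaw_finset (hW : IsWienerProcess μ W) (I : Finset ℝ) :
    HasGaussianLaw (fun ω (t : I) ↦ W t ω) μ := by
  -- The criterion for independent increments needs an initial time at which the process vanishes.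
  -- So `W - W m` is used on `[m, ∞)`, and `W t = X t - X 0` is recovered from `W 0 = 0`; this is
  -- why `0` is inserted.
  obtain ⟨m, hm⟩ : ∃ m : ℝ, m ∈ lowerBounds ((insert 0 I : Finset ℝ) : Set ℝ) :=
    (insert 0 I : Finset ℝ).bddBelow
  have hm0 : m ≤ 0 := hm (by simp)
  have hmI (t : I) : m ≤ t := hm (by simp)
  set X : Set.Ici m → Ω → E d := fun t ω ↦ W t ω - W m ω with hXdef
  have hX : IsGaussianProcess X μ := by
    refine HasIndepIncrements.isGaussianProcess (fun t ↦ hW.hasGaussianLaw_sub t.2)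
      (ae_of_all _ fun ω ↦ ?_) fun N t ht ↦ ?_
    · exact sub_self (W m ω)
    · have := hW.indep N (fun i ↦ (t i : ℝ)) fun i j hij ↦ ht hij
      simpa [hXdef] using this
  have hY : IsGaussianProcess (fun (t : I) ω ↦ X ⟨t, hmI t⟩ ω - X ⟨0, hm0⟩ ω) μ := by
    classical
    refine hX.of_isGaussianProcess fun t ↦ ⟨{⟨t, hmI t⟩, ⟨0, hm0⟩},
      ContinuousLinearMap.proj ⟨⟨t, hmI t⟩, by simp⟩ -
        ContinuousLinearMap.proj ⟨⟨0, hm0⟩, by simp⟩, fun ω ↦ by simp⟩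
  have hZ : IsGaussianProcess (fun (t : I) ω ↦ W t ω) μ := by
    refine hY.congr fun t ↦ ?_
    filter_upwards [hW.zero] with ω hω
    simp [hXdef, hω]
  exact (hZ.hasGaussianLaw Finset.univ).map
    (ContinuousLinearMap.pi fun i : I ↦
      .proj (R := ℝ) (⟨i, Finset.mem_univ _⟩ : (Finset.univ : Finset I)))

lemma hasGaussianLaw_eval (hW : IsWienerProcess μ W) (t : ℝ) : HasGaussianLaw (W t) μ :=
  (hW.hasGaussianLaw_finset {t}).map
    (ContinuousLinearMap.proj (R := ℝ) (⟨t, Finset.mem_singleton_self t⟩ : ({t} : Finset ℝ)))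

lemma integral_sub (hW : IsWienerProcess μ W) {s t : ℝ} (hst : s ≤ t) :
    ∫ ω, (W t ω - W s ω) ∂μ = 0 := by
  rw [(hW.law s t hst).integral_eq, integral_id_multivariateGaussian]

lemma integral_eval (hW : IsWienerProcess μ W) (t : ℝ) : ∫ ω, W t ω ∂μ = 0 := by
  rcases le_total 0 t with ht | ht
  · rw [← hW.integral_sub ht]
    refine integral_congr_ae ?_
    filter_upwards [hW.zero] with ω hω
    simp [hω]
  · rw [← neg_eq_zero, ← integral_neg, ← hW.integral_sub ht]
    refine integral_congr_ae ?_
    filter_upwards [hW.zero] with ω hω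
    simp [hω]

lemma hasGaussianLaw_of_mem_wienerSpan (hW : IsWienerProcess μ W) {X : Ω → ℝ}
    (hX : X ∈ wienerSpan W) : HasGaussianLaw X μ := by
  obtain ⟨I, L, hL⟩ := exists_eq_comp_restrict_of_mem_wienerSpan hX
  have : X = fun ω ↦ L (fun t : I ↦ W t ω) := funext hL
  rw [this]
  exact (hW.hasGaussianLaw_finset I).map_fun L

lemma integral_of_mem_wienerSpan (hW : IsWienerProcess μ W) {X : Ω → ℝ}
    (hX : X ∈ wienerSpan W) : ∫ ω, X ω ∂μ = 0 := by
  induction hX using Submodule.span_induction with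
  | mem X hX =>
    obtain ⟨p, rfl⟩ := hX
    simp only
    rw [integral_inner (hW.hasGaussianLaw_eval _).integrable, hW.integral_eval, inner_zero_right]
  | zero => simp
  | add X Y hX hY h1 h2 =>
    simp only [Pi.add_apply]
    rw [integral_add (hW.hasGaussianLaw_of_mem_wienerSpan hX).integrable
      (hW.hasGaussianLaw_of_mem_wienerSpan hY).integrable, h1, h2, add_zero]
  | smul c X _ h =>
    simp only [Pi.smul_apply, smul_eq_mul]
    rw [integral_const_mul, h, mul_zero]

lemma wienerSpan_le_gaussianSpace (hW : IsWienerProcess μ W) :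
    wienerSpan W ≤ gaussianSpace μ W := fun X hX ↦
  ⟨(hW.hasGaussianLaw_of_mem_wienerSpan hX).memLp_two, fun _ ↦ X,
    fun _ ↦ ⟨hX, (hW.hasGaussianLaw_of_mem_wienerSpan hX).memLp_two⟩, by simp⟩

variable [IsProbabilityMeasure μ]

lemma hasGaussianLaw_and_integral_of_mem (hW : IsWienerProcess μ W) {X : Ω → ℝ}
    (hX : X ∈ gaussianSpace μ W) : HasGaussianLaw X μ ∧ ∫ ω, X ω ∂μ = 0 := by
  obtain ⟨hX2, x, hx, hlim⟩ := hX
  exact hasGaussianLaw_of_tendsto_eLpNorm hX2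
    (fun k ↦ hW.hasGaussianLaw_of_mem_wienerSpan (hx k).1)
    (fun k ↦ hW.integral_of_mem_wienerSpan (hx k).1) hlim

/-- Every family in the Gaussian space of a Wiener process is a Gaussian process. -/
lemma isGaussianProcess_of_mem (hW : IsWienerProcess μ W) {T : Type*} {Z : T → Ω → ℝ}
    (hZ : ∀ t, Z t ∈ gaussianSpace μ W) : IsGaussianProcess Z μ where
  hasGaussianLaw I := by
    have hm : AEMeasurable (fun ω ↦ I.restrict (Z · ω)) μ :=
      aemeasurable_pi_lambda _ fun t ↦ (hZ t).1.1.aemeasurable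
    refine ⟨isGaussian_of_isGaussian_map fun L ↦ ?_⟩
    rw [AEMeasurable.map_map_of_aemeasurable (by fun_prop) hm]
    refine HasGaussianLaw.isGaussian_map (hW.hasGaussianLaw_and_integral_of_mem ?_).1
    classical
    -- Joint Gaussianity is tested on linear functionals, and linear combinations stay in the
    -- Gaussian space.
    have h : (L ∘ fun ω ↦ I.restrict (Z · ω)) =
        ∑ t : I, L (Pi.single t 1) • Z t := by
      ext ω
      have h1 : I.restrict (Z · ω) = ∑ t : I, Z t ω • (Pi.single t (1 : ℝ) : I → ℝ) := by
        ext t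
        simp [Finset.sum_apply, Pi.single_apply]
      simp only [Function.comp_apply, h1, map_sum, map_smul, Finset.sum_apply, Pi.smul_apply,
        smul_eq_mul]
      exact Finset.sum_congr rfl fun t _ ↦ mul_comm _ _
    rw [h]
    exact Submodule.sum_mem _ fun t _ ↦ Submodule.smul_mem _ _ (hZ t)

lemma integral_exp_of_mem (hW : IsWienerProcess μ W) {X : Ω → ℝ} (hX : X ∈ gaussianSpace μ W) :
    ∫ ω, Complex.exp (X ω * Complex.I) ∂μ = Complex.exp (-(∫ ω, X ω ^ 2 ∂μ : ℝ) / 2) := by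
  obtain ⟨hg, h0⟩ := hW.hasGaussianLaw_and_integral_of_mem hX
  have h := hg.charFun_map_eq 1
  rw [charFun_apply, integral_map hX.1.1.aemeasurable (by fun_prop)] at h
  simp only [RCLike.inner_apply, conj_trivial, one_mul, mul_one] at h
  rw [h, h0, variance_of_integral_eq_zero hX.1.1.aemeasurable h0]
  simp [neg_div]

omit [IsProbabilityMeasure μ] in
lemma wienerFiltration_le (hW : IsWienerProcess μ W) (t : ℝ) : wienerFiltration W t ≤ mΩ :=
  iSup₂_le fun s _ ↦ (hW.measurable s).comap_le

/-- Random variables of the Gaussian space which are orthogonal to `W_s`, `s ≤ 0`, are independent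
of the past of `W`. -/
lemma indep_wienerFiltration (hW : IsWienerProcess μ W) {T : Type*} {Y : T → Ω → ℝ}
    (hY : ∀ t, Y t ∈ gaussianSpace μ W)
    (h : ∀ t, ∀ s ≤ 0, ∀ w, ∫ ω, ⟪w, W s ω⟫ * Y t ω ∂μ = 0) :
    Indep (wienerFiltration W 0) (MeasurableSpace.comap (fun ω t ↦ Y t ω) inferInstance) μ := by
  let X : Set.Iic (0 : ℝ) × Fin d → Ω → ℝ := fun p ω ↦ W p.1 ω p.2
  have hXw (p : Set.Iic (0 : ℝ) × Fin d) :
      X p = fun ω ↦ ⟪EuclideanSpace.single p.2 (1 : ℝ), W p.1 ω⟫ := by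
    ext ω
    simp [X, EuclideanSpace.inner_single_left]
  have hX (p) : X p ∈ gaussianSpace μ W := by
    rw [hXw]
    exact hW.wienerSpan_le_gaussianSpace (Submodule.subset_span ⟨(_, p.1), rfl⟩)
  -- Past coordinates and `Y` together form one Gaussian process, for which vanishing covariances
  -- imply independence.
  have hmem : ∀ p, Sum.elim X Y p ∈ gaussianSpace μ W := by
    rintro (p | t)
    exacts [hX p, hY t]
  have hind := (hW.isGaussianProcess_of_mem hmem).indepFun_of_covariance_eq_zero
    (fun p ↦ (hX p).1.1.aemeasurable) (fun t ↦ (hY t).1.1.aemeasurable) fun p t ↦ by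
      rw [covariance_eq_sub (hX p).1 (hY t).1, (hW.hasGaussianLaw_and_integral_of_mem (hX p)).2,
        zero_mul, sub_zero]
      simp only [Pi.mul_apply, hXw]
      exact h t _ p.1.2 _
  rw [IndepFun_iff_Indep] at hind
  refine indep_of_indep_of_le_left hind (iSup₂_le fun s hs ↦ ?_)
  have hW' : W s = (fun z : Set.Iic (0 : ℝ) × Fin d → ℝ ↦
      (WithLp.toLp 2 fun i ↦ z (⟨s, hs⟩, i) : E d)) ∘ fun ω p ↦ X p ω := by
    ext ω i; rfl
  rw [hW', ← MeasurableSpace.comap_comp]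
  exact MeasurableSpace.comap_mono (measurable_iff_comap_le.1 (by fun_prop))

end IsWienerProcess

end

/-! ### The Wiener integral -/

section

variable {Ω : Type*} {mΩ : MeasurableSpace Ω} {μ : Measure Ω} {d : ℕ} {W : ℝ → Ω → E d}

namespace IsWienerProcess

lemma memLp_inner_sub (hW : IsWienerProcess μ W) (w : E d) (s t : ℝ) :
    MemLp (fun ω ↦ ⟪w, W t ω - W s ω⟫) 2 μ :=
  (hW.wienerSpan_le_gaussianSpace (inner_sub_mem_wienerSpan W w s t)).1

lemma integrable_inner_sub_mul_inner_sub (hW : IsWienerProcess μ W) (v w : E d) (r s t u : ℝ) :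
    Integrable (fun ω ↦ ⟪v, W s ω - W r ω⟫ * ⟪w, W u ω - W t ω⟫) μ :=
  (hW.memLp_inner_sub v r s).integrable_mul (hW.memLp_inner_sub w t u)

lemma integral_inner_sub (hW : IsWienerProcess μ W) (w : E d) (s t : ℝ) :
    ∫ ω, ⟪w, W t ω - W s ω⟫ ∂μ = 0 :=
  hW.integral_of_mem_wienerSpan (inner_sub_mem_wienerSpan W w s t)

lemma integral_inner_sub_mul_inner_sub_self (hW : IsWienerProcess μ W) (v w : E d) {s t : ℝ}
    (hst : s ≤ t) :
    ∫ ω, ⟪v, W t ω - W s ω⟫ * ⟪w, W t ω - W s ω⟫ ∂μ = (t - s) * ⟪v, w⟫ := by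
  have hpos : ((t - s) • (1 : Matrix (Fin d) (Fin d) ℝ)).PosSemidef :=
    Matrix.PosSemidef.one.smul (sub_nonneg.2 hst)
  have h := covarianceBilin_multivariateGaussian (μ := (0 : E d)) hpos v w
  rw [covarianceBilin_apply IsGaussian.memLp_two_id] at h
  simp only [integral_id_multivariateGaussian', sub_zero] at h
  have h2 := (hW.law s t hst).integral_comp (f := fun x ↦ ⟪v, x⟫ * ⟪w, x⟫) (by fun_prop)
  simp only [Function.comp_def] at h2
  rw [h2, h, Matrix.smul_mulVec, Matrix.one_mulVec, dotProduct_smul, smul_eq_mul, PiLp.inner_apply]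
  simp [dotProduct, mul_comm]

lemma integral_inner_sub_mul_inner_sub_of_le (hW : IsWienerProcess μ W) (v w : E d) {r s t u : ℝ}
    (hrs : r ≤ s) (hst : s ≤ t) (htu : t ≤ u) :
    ∫ ω, ⟪v, W s ω - W r ω⟫ * ⟪w, W u ω - W t ω⟫ ∂μ = 0 := by
  have h1 : IndepFun (W s - W r) (W u - W t) μ := by
    have h := hW.indep 3 ![r, s, t, u] (by
      intro i j hij
      fin_cases i <;> fin_cases j <;> simp at hij ⊢ <;> linarith)
    exact h.indepFun (i := 0) (j := 2) (by decide)
  have h2 := h1.comp (show Measurable fun x : E d ↦ ⟪v, x⟫ by fun_prop)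
    (show Measurable fun x : E d ↦ ⟪w, x⟫ by fun_prop)
  have h3 := h2.integral_mul_eq_mul_integral (hW.memLp_inner_sub v r s).1
    (hW.memLp_inner_sub w t u).1
  simp only [Pi.mul_apply, Function.comp_apply, Pi.sub_apply] at h3
  rw [h3, hW.integral_inner_sub, zero_mul]

lemma integral_inner_sub_mul_inner_sub_of_le_left (hW : IsWienerProcess μ W) (v w : E d)
    {m s t : ℝ} (hs : m ≤ s) (hst : s ≤ t) :
    ∫ ω, ⟪v, W s ω - W m ω⟫ * ⟪w, W t ω - W m ω⟫ ∂μ = (s - m) * ⟪v, w⟫ := by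
  have h (ω : Ω) : ⟪v, W s ω - W m ω⟫ * ⟪w, W t ω - W m ω⟫ =
      ⟪v, W s ω - W m ω⟫ * ⟪w, W s ω - W m ω⟫ + ⟪v, W s ω - W m ω⟫ * ⟪w, W t ω - W s ω⟫ := by
    rw [← mul_add, ← inner_add_right]
    congr 2
    abel
  simp_rw [h]
  rw [integral_add (hW.integrable_inner_sub_mul_inner_sub _ _ _ _ _ _)
    (hW.integrable_inner_sub_mul_inner_sub _ _ _ _ _ _),
    hW.integral_inner_sub_mul_inner_sub_self v w hs,
    hW.integral_inner_sub_mul_inner_sub_of_le v w hs le_rfl hst, add_zero]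

lemma integral_inner_sub_mul_inner_sub_min (hW : IsWienerProcess μ W) (v w : E d)
    {m s t : ℝ} (hs : m ≤ s) (ht : m ≤ t) :
    ∫ ω, ⟪v, W s ω - W m ω⟫ * ⟪w, W t ω - W m ω⟫ ∂μ = (min s t - m) * ⟪v, w⟫ := by
  rcases le_total s t with hst | hst
  · rw [hW.integral_inner_sub_mul_inner_sub_of_le_left v w hs hst, min_eq_left hst]
  · simp_rw [mul_comm ⟪v, _⟫]
    rw [hW.integral_inner_sub_mul_inner_sub_of_le_left w v ht hst, min_eq_right hst,
      real_inner_comm]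

/-- The covariance of two increments of a Wiener process. -/
lemma integral_increment_mul_increment (hW : IsWienerProcess μ W) (v w : E d) {a b a' b' : ℝ}
    (hab : a ≤ b) (hab' : a' ≤ b') :
    ∫ ω, ⟪v, W b ω - W a ω⟫ * ⟪w, W b' ω - W a' ω⟫ ∂μ =
      max (min b b' - max a a') 0 * ⟪v, w⟫ := by
  -- With increments measured from a common base point `m`, the covariance is `min s t - m`; the
  -- four resulting terms combine to the length of the overlap of the two intervals.
  set m := min a a' with hm
  have ha : m ≤ a := min_le_left _ _
  have ha' : m ≤ a' := min_le_right _ _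
  have hb : m ≤ b := ha.trans hab
  have hb' : m ≤ b' := ha'.trans hab'
  have hi (s t : ℝ) : Integrable (fun ω ↦ ⟪v, W s ω - W m ω⟫ * ⟪w, W t ω - W m ω⟫) μ :=
    hW.integrable_inner_sub_mul_inner_sub _ _ _ _ _ _
  have h (ω : Ω) : ⟪v, W b ω - W a ω⟫ * ⟪w, W b' ω - W a' ω⟫ =
      (⟪v, W b ω - W m ω⟫ * ⟪w, W b' ω - W m ω⟫ - ⟪v, W b ω - W m ω⟫ * ⟪w, W a' ω - W m ω⟫) -
      (⟪v, W a ω - W m ω⟫ * ⟪w, W b' ω - W m ω⟫ - ⟪v, W a ω - W m ω⟫ * ⟪w, W a' ω - W m ω⟫) := by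
    simp only [inner_sub_right]
    ring
  simp_rw [h]
  have hi2 (r s t : ℝ) : Integrable (fun ω ↦ ⟪v, W r ω - W m ω⟫ * ⟪w, W s ω - W m ω⟫ -
      ⟪v, W r ω - W m ω⟫ * ⟪w, W t ω - W m ω⟫) μ := (hi r s).sub (hi r t)
  rw [MeasureTheory.integral_sub (hi2 _ _ _) (hi2 _ _ _),
    MeasureTheory.integral_sub (hi _ _) (hi _ _), MeasureTheory.integral_sub (hi _ _) (hi _ _),
    hW.integral_inner_sub_mul_inner_sub_min v w hb hb',
    hW.integral_inner_sub_mul_inner_sub_min v w hb ha',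
    hW.integral_inner_sub_mul_inner_sub_min v w ha hb',
    hW.integral_inner_sub_mul_inner_sub_min v w ha ha']
  have key : (min b b' - m) - (min b a' - m) - ((min a b' - m) - (min a a' - m)) =
      max (min b b' - max a a') 0 := by
    grind
  rw [← key]
  ring

end IsWienerProcess

namespace StepFunction

lemma memLp_indicator_Ioc (a b : ℝ) (w : E d) :
    MemLp ((Set.Ioc a b).indicator fun _ ↦ w) 2 volume :=
  memLp_indicator_const 2 measurableSet_Ioc w (Or.inr (by simp))

lemma memLp_eval (f : StepFunction d) : MemLp f.eval 2 volume := by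
  have h : f.eval = ∑ i, (Set.Ioc (f.a i) (f.b i)).indicator fun _ ↦ f.v i := by
    ext u
    simp [eval, Finset.sum_apply]
  rw [h]
  exact memLp_finsetSum' _ fun i _ ↦ memLp_indicator_Ioc _ _ _

lemma integral_mem_wienerSpan (f : StepFunction d) (W : ℝ → Ω → E d) :
    f.integral W ∈ wienerSpan W := by
  have h : f.integral W = ∑ i, fun ω ↦ ⟪f.v i, W (f.b i) ω - W (f.a i) ω⟫ := by
    ext ω
    simp [integral, Finset.sum_apply]
  rw [h]
  exact Submodule.sum_mem _ fun i _ ↦ inner_sub_mem_wienerSpan W _ _ _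

lemma integral_inner_indicator_Ioc (v w : E d) (a b a' b' : ℝ) :
    ∫ u, ⟪(Set.Ioc a b).indicator (fun _ ↦ v) u, (Set.Ioc a' b').indicator (fun _ ↦ w) u⟫ =
      max (min b b' - max a a') 0 * ⟪v, w⟫ := by
  have h (u : ℝ) : ⟪(Set.Ioc a b).indicator (fun _ ↦ v) u,
      (Set.Ioc a' b').indicator (fun _ ↦ w) u⟫ =
      (Set.Ioc a b ∩ Set.Ioc a' b').indicator (fun _ ↦ ⟪v, w⟫) u := by
    by_cases h1 : u ∈ Set.Ioc a b <;> by_cases h2 : u ∈ Set.Ioc a' b' <;>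
      simp [Set.indicator, h1, h2, -Set.mem_Ioc]
  simp_rw [h]
  rw [integral_indicator_const _ (measurableSet_Ioc.inter measurableSet_Ioc), Set.Ioc_inter_Ioc,
    Real.volume_real_Ioc, smul_eq_mul]

lemma integrable_inner_indicator_Ioc (v w : E d) (a b a' b' : ℝ) :
    Integrable fun u ↦ ⟪(Set.Ioc a b).indicator (fun _ ↦ v) u,
      (Set.Ioc a' b').indicator (fun _ ↦ w) u⟫ := by
  have h1 := memLp_indicator_Ioc a b v
  have h2 := memLp_indicator_Ioc a' b' w
  refine (L2.integrable_inner (𝕜 := ℝ) h1.toLp h2.toLp).congr ?_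
  filter_upwards [h1.coeFn_toLp, h2.coeFn_toLp] with u hu hu'
  rw [hu, hu']

/-- The elementary integral is an isometry. -/
lemma integral_integral_mul_integral (hW : IsWienerProcess μ W) (f g : StepFunction d) :
    ∫ ω, f.integral W ω * g.integral W ω ∂μ = ∫ u, ⟪f.eval u, g.eval u⟫ := by
  simp only [integral, eval, Finset.sum_mul_sum, sum_inner]
  simp only [inner_sum]
  rw [integral_finsetSum, integral_finsetSum]
  · refine Finset.sum_congr rfl fun i _ ↦ ?_
    rw [integral_finsetSum, integral_finsetSum]
    · refine Finset.sum_congr rfl fun j _ ↦ ?_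
      rw [integral_inner_indicator_Ioc,
        hW.integral_increment_mul_increment _ _ (f.a_le_b i) (g.a_le_b j)]
    · exact fun j _ ↦ integrable_inner_indicator_Ioc _ _ _ _ _ _
    · exact fun j _ ↦ hW.integrable_inner_sub_mul_inner_sub _ _ _ _ _ _
  · exact fun i _ ↦ integrable_finsetSum _ fun j _ ↦
      integrable_inner_indicator_Ioc _ _ _ _ _ _
  · exact fun i _ ↦ integrable_finsetSum _ fun j _ ↦
      hW.integrable_inner_sub_mul_inner_sub _ _ _ _ _ _

/-- The restriction of a step function to the half line `(-∞, 0]`. -/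
def past (f : StepFunction d) : StepFunction d where
  size := f.size
  a i := min (f.a i) 0
  b i := min (f.b i) 0
  a_le_b i := min_le_min_right 0 (f.a_le_b i)
  v := f.v

/-- Truncating both endpoints at `0` intersects the interval with the half line; an interval in the
future collapses to the empty `(0, 0]`. -/
lemma past_eval (f : StepFunction d) : f.past.eval = (Set.Iic 0).indicator f.eval := by
  ext1 u
  have h : (Set.Iic (0 : ℝ)).indicator f.eval u =
      ∑ i, (Set.Iic (0 : ℝ)).indicator ((Set.Ioc (f.a i) (f.b i)).indicator fun _ ↦ f.v i) u := by
    by_cases hu : u ∈ Set.Iic (0 : ℝ)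
    · simp [Set.indicator_of_mem hu, eval]
    · simp [Set.indicator_of_notMem hu]
  rw [h]
  refine Finset.sum_congr rfl fun i _ ↦ ?_
  rw [Set.indicator_indicator]
  have hset : Set.Ioc (f.past.a i) (f.past.b i) = Set.Iic 0 ∩ Set.Ioc (f.a i) (f.b i) := by
    ext u
    simp only [past, Set.mem_Ioc, Set.mem_inter_iff, Set.mem_Iic]
    grind
  rw [hset]
  rfl

end StepFunction

namespace IsWienerIntegral

variable {h g : ℝ → E d} {X Y : Ω → ℝ}

lemma mem_gaussianSpace (hW : IsWienerProcess μ W) (hX : IsWienerIntegral μ W h X) :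
    X ∈ gaussianSpace μ W := by
  obtain ⟨_, hX2, f, _, hf⟩ := hX
  exact ⟨hX2, fun k ↦ (f k).integral W, fun k ↦ ⟨(f k).integral_mem_wienerSpan W,
    (hW.wienerSpan_le_gaussianSpace ((f k).integral_mem_wienerSpan W)).1⟩, hf⟩

/-- The Wiener integral is an isometry. -/
lemma integral_mul (hW : IsWienerProcess μ W) (hX : IsWienerIntegral μ W h X)
    (hY : IsWienerIntegral μ W g Y) : ∫ ω, X ω * Y ω ∂μ = ∫ u, ⟪h u, g u⟫ := by
  obtain ⟨hh, hX2, f, hfh, hfX⟩ := hX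
  obtain ⟨hg, hY2, f', hfg, hfY⟩ := hY
  have hmem (f : StepFunction d) : MemLp (f.integral W) 2 μ :=
    (hW.wienerSpan_le_gaussianSpace (f.integral_mem_wienerSpan W)).1
  have h1 := tendsto_integral_inner_of_tendsto_eLpNorm hX2 hY2 (fun k ↦ hmem (f k))
    (fun k ↦ hmem (f' k)) hfX hfY
  have h2 := tendsto_integral_inner_of_tendsto_eLpNorm hh hg (fun k ↦ (f k).memLp_eval)
    (fun k ↦ (f' k).memLp_eval) hfh hfg
  have h3 (k : ℕ) : ∫ ω, ⟪(f k).integral W ω, (f' k).integral W ω⟫ ∂μ =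
      ∫ u, ⟪(f k).eval u, (f' k).eval u⟫ := by
    rw [← StepFunction.integral_integral_mul_integral hW]
    simp [mul_comm]
  simp_rw [h3] at h1
  have h4 := tendsto_nhds_unique h1 h2
  simpa [mul_comm] using h4

lemma congr_ae (hX : IsWienerIntegral μ W h X) (hXY : X =ᵐ[μ] Y) : IsWienerIntegral μ W h Y := by
  obtain ⟨hh, hX2, f, hfh, hfX⟩ := hX
  refine ⟨hh, (memLp_congr_ae hXY).1 hX2, f, hfh, hfX.congr fun k ↦ eLpNorm_congr_ae ?_⟩
  filter_upwards [hXY] with ω hω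
  rw [hω]

end IsWienerIntegral

variable [IsProbabilityMeasure μ]

lemma IsWienerProcess.condExp_increment_of_le (hW : IsWienerProcess μ W) (w : E d) {s t : ℝ}
    (hs : s ≤ 0) (ht : t ≤ 0) :
    μ[fun ω ↦ ⟪w, W t ω - W s ω⟫ | wienerFiltration W 0] = fun ω ↦ ⟪w, W t ω - W s ω⟫ := by
  have hm (r : ℝ) (hr : r ≤ 0) : Measurable[wienerFiltration W 0] (W r) :=
    measurable_iff_comap_le.2 (le_iSup₂_of_le r hr le_rfl)
  refine condExp_of_stronglyMeasurable (hW.wienerFiltration_le 0) ?_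
    ((hW.memLp_inner_sub w s t).integrable one_le_two)
  exact (Measurable.const_inner ((hm t ht).sub (hm s hs))).stronglyMeasurable

lemma IsWienerProcess.condExp_increment_of_ge (hW : IsWienerProcess μ W) (w : E d) {s t : ℝ}
    (hs : 0 ≤ s) (hst : s ≤ t) :
    μ[fun ω ↦ ⟪w, W t ω - W s ω⟫ | wienerFiltration W 0] =ᵐ[μ] 0 := by
  have hmem := hW.wienerSpan_le_gaussianSpace (inner_sub_mem_wienerSpan W w s t)
  have hind := hW.indep_wienerFiltration (Y := fun _ : Unit ↦ fun ω ↦ ⟪w, W t ω - W s ω⟫)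
    (fun _ ↦ hmem) fun _ r hr v ↦ by
      -- Almost surely `W r = -(W 0 - W r)`, which is minus an increment over the past.
      rw [← neg_eq_zero, ← integral_neg,
        ← hW.integral_inner_sub_mul_inner_sub_of_le v w hr hs hst]
      refine integral_congr_ae ?_
      filter_upwards [hW.zero] with ω hω
      simp [hω]
  have hm : Measurable fun ω ↦ ⟪w, W t ω - W s ω⟫ :=
    Measurable.const_inner ((hW.measurable t).sub (hW.measurable s))
  have hle : MeasurableSpace.comap (fun ω ↦ ⟪w, W t ω - W s ω⟫) inferInstance ≤
      MeasurableSpace.comap (fun ω (_ : Unit) ↦ ⟪w, W t ω - W s ω⟫) inferInstance := by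
    have h1 : (fun ω ↦ ⟪w, W t ω - W s ω⟫) =
        (fun z : Unit → ℝ ↦ z ()) ∘ fun ω (_ : Unit) ↦ ⟪w, W t ω - W s ω⟫ := rfl
    conv_lhs => rw [h1, ← MeasurableSpace.comap_comp]
    exact MeasurableSpace.comap_mono (measurable_iff_comap_le.1 (by fun_prop))
  have h := condExp_indep_eq hm.comap_le (hW.wienerFiltration_le 0)
    (comap_measurable _).stronglyMeasurable (indep_of_indep_of_le_right hind hle).symm
  refine h.trans (ae_of_all _ fun ω ↦ ?_)
  simp [hW.integral_inner_sub]

/-- The conditional expectation of an increment given the past. -/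
lemma IsWienerProcess.condExp_increment (hW : IsWienerProcess μ W) (w : E d) {s t : ℝ}
    (hst : s ≤ t) :
    μ[fun ω ↦ ⟪w, W t ω - W s ω⟫ | wienerFiltration W 0] =ᵐ[μ]
      fun ω ↦ ⟪w, W (min t 0) ω - W (min s 0) ω⟫ := by
  -- The increment is cut at time `0` into a measurable part and an independent centered part.
  have h : (fun ω ↦ ⟪w, W t ω - W s ω⟫) = (fun ω ↦ ⟪w, W (min t 0) ω - W (min s 0) ω⟫) +
      fun ω ↦ ⟪w, W (max t 0) ω - W (max s 0) ω⟫ := by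
    ext ω
    rw [Pi.add_apply, ← inner_add_right]
    congr 1
    rcases le_total t 0 with ht | ht <;> rcases le_total s 0 with hs | hs <;>
      simp [ht, hs]
  rw [h]
  refine (condExp_add ((hW.memLp_inner_sub _ _ _).integrable one_le_two)
    ((hW.memLp_inner_sub _ _ _).integrable one_le_two) _).trans ?_
  rw [hW.condExp_increment_of_le w (min_le_right _ _) (min_le_right _ _)]
  filter_upwards [hW.condExp_increment_of_ge w (le_max_right s 0) (max_le_max_right 0 hst)]
    with ω hω
  simp [hω]

lemma StepFunction.condExp_integral (hW : IsWienerProcess μ W) (f : StepFunction d) :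
    μ[f.integral W | wienerFiltration W 0] =ᵐ[μ] f.past.integral W := by
  have h : f.integral W = ∑ i, fun ω ↦ ⟪f.v i, W (f.b i) ω - W (f.a i) ω⟫ := by
    ext ω
    simp [integral, Finset.sum_apply]
  rw [h]
  refine (condExp_finsetSum
    (fun i _ ↦ (hW.memLp_inner_sub _ _ _).integrable one_le_two) _).trans ?_
  have hae : ∀ᵐ ω ∂μ, ∀ i, (μ[fun ω ↦ ⟪f.v i, W (f.b i) ω - W (f.a i) ω⟫ |
      wienerFiltration W 0]) ω = ⟪f.v i, W (min (f.b i) 0) ω - W (min (f.a i) 0) ω⟫ :=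
    ae_all_iff.2 fun i ↦ hW.condExp_increment (f.v i) (f.a_le_b i)
  filter_upwards [hae] with ω hω
  rw [Finset.sum_apply]
  exact Finset.sum_congr rfl fun i _ ↦ hω i

/-- The conditional expectation of a Wiener integral given the past is the Wiener integral over
the past. -/
lemma IsWienerIntegral.condExp (hW : IsWienerProcess μ W) {h : ℝ → E d} {X : Ω → ℝ}
    (hX : IsWienerIntegral μ W h X) :
    IsWienerIntegral μ W ((Set.Iic 0).indicator h) (μ[X | wienerFiltration W 0]) := by
  obtain ⟨hh, hX2, f, hfh, hfX⟩ := hX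
  refine ⟨hh.indicator measurableSet_Iic, hX2.condExp one_le_two, fun k ↦ (f k).past, ?_, ?_⟩
  · refine tendsto_of_tendsto_of_tendsto_of_le_of_le tendsto_const_nhds hfh
      (fun _ ↦ zero_le) fun k ↦ ?_
    have h1 : (fun u ↦ (f k).past.eval u - (Set.Iic 0).indicator h u) =
        (Set.Iic 0).indicator fun u ↦ (f k).eval u - h u := by
      ext1 u
      rw [StepFunction.past_eval]
      by_cases hu : u ∈ Set.Iic (0 : ℝ)
      · simp only [Set.indicator_of_mem hu]
      · simp [Set.indicator_of_notMem hu]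
    simp only [h1]
    exact eLpNorm_indicator_le _
  · refine tendsto_of_tendsto_of_tendsto_of_le_of_le tendsto_const_nhds hfX
      (fun _ ↦ zero_le) fun k ↦ ?_
    have hmem : MemLp ((f k).integral W) 2 μ :=
      (hW.wienerSpan_le_gaussianSpace ((f k).integral_mem_wienerSpan W)).1
    -- Truncated step functions still approximate, because conditional expectation is an
    -- `L²`-contraction that sends the elementary integral to its past part.
    have h1 : (fun ω ↦ (f k).past.integral W ω - (μ[X | wienerFiltration W 0]) ω) =ᵐ[μ]
        μ[(f k).integral W - X | wienerFiltration W 0] := by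
      filter_upwards [condExp_sub (hmem.integrable one_le_two) (hX2.integrable one_le_two)
        (wienerFiltration W 0), (f k).condExp_integral hW] with ω h2 h3
      rw [h2, Pi.sub_apply, h3]
    simp only
    rw [eLpNorm_congr_ae h1]
    exact eLpNorm_condExp_le_eLpNorm _ one_le_two

end

/-! ### Conditional expectations of functionals of Wiener integrals -/

lemma inner_toEuclideanCLM_eq {n : ℕ} (N : Matrix (Fin n) (Fin n) ℝ) (x w : E n) :
    ⟪x, Matrix.toEuclideanCLM (𝕜 := ℝ) N w⟫ = ⟪Matrix.toEuclideanCLM (𝕜 := ℝ) Nᵀ x, w⟫ := by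
  rw [Matrix.inner_toEuclideanCLM, real_inner_comm, Matrix.dotProduct_mulVec,
    ← Matrix.mulVec_transpose]
  simp [PiLp.inner_apply, dotProduct, Matrix.ofLp_toEuclideanCLM]

section

variable {Ω : Type*} {mΩ : MeasurableSpace Ω} {μ : Measure Ω} {d n : ℕ} {W : ℝ → Ω → E d}

lemma measurable_of_forall_coord {m : MeasurableSpace Ω} {Z : Ω → E n}
    (hZ : ∀ j, Measurable fun ω ↦ Z ω j) : Measurable Z :=
  (WithLp.measurable_toLp 2 _).comp (measurable_pi_lambda _ hZ)

lemma memLp_of_forall_coord {Z : Ω → E n} (hZ : ∀ j, MemLp (fun ω ↦ Z ω j) 2 μ) :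
    MemLp Z 2 μ := by
  have h : Z = ∑ j, fun ω ↦ Z ω j • EuclideanSpace.single j (1 : ℝ) := by
    ext ω i
    simp [Finset.sum_apply, Pi.single_apply]
  rw [h]
  exact memLp_finsetSum' _ fun j _ ↦
    ((ContinuousLinearMap.id ℝ ℝ).smulRight (EuclideanSpace.single j (1 : ℝ))).comp_memLp' (hZ j)

lemma inner_mem_gaussianSpace {Z : Ω → E n} (hZ : ∀ j, (fun ω ↦ Z ω j) ∈ gaussianSpace μ W)
    (x : E n) : (fun ω ↦ ⟪x, Z ω⟫) ∈ gaussianSpace μ W := by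
  have h : (fun ω ↦ ⟪x, Z ω⟫) = ∑ j, x j • fun ω ↦ Z ω j := by
    ext ω
    simp [PiLp.inner_apply, Finset.sum_apply, mul_comm]
  rw [h]
  exact Submodule.sum_mem _ fun j _ ↦ Submodule.smul_mem _ _ (hZ j)

lemma integral_inner_toEuclideanCLM_sq {w : Ω → E n} (hw : MemLp w 2 μ)
    {N : Matrix (Fin n) (Fin n) ℝ} (hN : N * momentMatrix μ w * Nᵀ = 1) (x : E n) :
    ∫ ω, ⟪x, Matrix.toEuclideanCLM (𝕜 := ℝ) N (w ω)⟫ ^ 2 ∂μ = ‖x‖ ^ 2 := by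
  have h : Nᵀ *ᵥ x.ofLp ⬝ᵥ momentMatrix μ w *ᵥ (Nᵀ *ᵥ x.ofLp) = x.ofLp ⬝ᵥ x.ofLp := by
    rw [Matrix.mulVec_transpose, ← Matrix.dotProduct_mulVec, ← Matrix.mulVec_transpose,
      Matrix.mulVec_mulVec, Matrix.mulVec_mulVec, hN, Matrix.one_mulVec]
  simp_rw [inner_toEuclideanCLM_eq]
  rw [← dotProduct_momentMatrix_mulVec hw, Matrix.ofLp_toEuclideanCLM, h,
    EuclideanSpace.real_norm_sq_eq, dotProduct]
  simp_rw [sq]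

variable [IsProbabilityMeasure μ]

lemma charFun_map_of_mem (hW : IsWienerProcess μ W) {Z : Ω → E n}
    (hZ : ∀ x, (fun ω ↦ ⟪x, Z ω⟫) ∈ gaussianSpace μ W) (hm : AEMeasurable Z μ) (x : E n) :
    charFun (μ.map Z) x = Complex.exp (-(∫ ω, ⟪x, Z ω⟫ ^ 2 ∂μ : ℝ) / 2) := by
  rw [charFun_apply, integral_map hm (by fun_prop), ← hW.integral_exp_of_mem (hZ x)]
  simp_rw [real_inner_comm]

lemma map_eq_multivariateGaussian (hW : IsWienerProcess μ W) {Z : Ω → E n}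
    (hZ : ∀ j, (fun ω ↦ Z ω j) ∈ gaussianSpace μ W) :
    μ.map Z = multivariateGaussian 0 (momentMatrix μ Z) := by
  have h2 := memLp_of_forall_coord fun j ↦ (hZ j).1
  have := Measure.isProbabilityMeasure_map h2.1.aemeasurable
  refine Measure.ext_of_charFun ?_
  ext x
  rw [charFun_map_of_mem hW (inner_mem_gaussianSpace hZ) h2.1.aemeasurable,
    charFun_multivariateGaussian (posSemidef_momentMatrix h2), dotProduct_momentMatrix_mulVec h2]
  simp [neg_div]

/-- Let `w` be a vector of Wiener integrals of `h 1, …, h n`, and let `N` be a matrix which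
standardizes `w`. Then the conditional expectation given the past contracts functions of `N w` which
are orthogonal to the Hermite polynomials of degree less than `k`, by a factor which is determined by
the energy of the `h j` on the negative half line. -/
theorem eLpNorm_condExp_comp_wienerIntegral_le (hW : IsWienerProcess μ W) {w : Ω → E n}
    {h : Fin n → ℝ → E d} (hw : ∀ j, IsWienerIntegral μ W (h j) fun ω ↦ w ω j)
    {N : Matrix (Fin n) (Fin n) ℝ} (hN : N * momentMatrix μ w * Nᵀ = 1)
    {c : ℝ} (hc0 : 0 ≤ c) (hc1 : c ≤ 1)
    (hc : ‖Matrix.toEuclideanCLM (𝕜 := ℝ) Nᵀ‖ ^ 2 * ∑ j, ∫ u in Set.Iic 0, ⟪h j u, h j u⟫ ≤ c ∨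
      c = 1)
    {F : E n → ℝ} (hF : MemLp F 2 (stdGaussian (E n))) {k : ℕ}
    (hk : ∀ l : Fin n → ℕ, ∑ i, l i < k →
      ∫ x, F x * hermiteMulti l x ∂(stdGaussian (E n)) = 0) :
    eLpNorm (μ[fun ω ↦ F (Matrix.toEuclideanCLM (𝕜 := ℝ) N (w ω)) | wienerFiltration W 0]) 2 μ ≤
      ENNReal.ofReal (√c ^ k) * eLpNorm F 2 (stdGaussian (E n)) := by
  set M := Matrix.toEuclideanCLM (𝕜 := ℝ) N with hM
  set M' := Matrix.toEuclideanCLM (𝕜 := ℝ) Nᵀ with hM'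
  have hMM' (x z : E n) : ⟪x, M z⟫ = ⟪M' x, z⟫ := inner_toEuclideanCLM_eq N x z
  have hle := hW.wienerFiltration_le 0
  have hw2 : MemLp w 2 μ := memLp_of_forall_coord fun j ↦ (hw j).2.1
  -- the past part and the future part
  set a : Ω → E n := fun ω ↦ WithLp.toLp 2 fun j ↦
    (μ[fun ω ↦ w ω j | wienerFiltration W 0]) ω with ha
  -- A measurable version of `w` is taken, since `w` is only almost everywhere measurable and `b`
  -- must be measurable.
  set b : Ω → E n := fun ω ↦ hw2.1.mk w ω - a ω with hb
  have haW (j : Fin n) :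
      IsWienerIntegral μ W ((Set.Iic 0).indicator (h j)) fun ω ↦ a ω j := (hw j).condExp hW
  have hwmk : w =ᵐ[μ] hw2.1.mk w := hw2.1.ae_eq_mk
  have hwj (j : Fin n) : IsWienerIntegral μ W (h j) fun ω ↦ hw2.1.mk w ω j := by
    refine (hw j).congr_ae ?_
    filter_upwards [hwmk] with ω hω
    rw [hω]
  have ham : Measurable[wienerFiltration W 0] a := by
    refine measurable_of_forall_coord fun j ↦ ?_
    exact stronglyMeasurable_condExp.measurable
  have hbm : Measurable b := hw2.1.stronglyMeasurable_mk.measurable.sub (ham.mono hle le_rfl)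
  have haG (j : Fin n) : (fun ω ↦ a ω j) ∈ gaussianSpace μ W := (haW j).mem_gaussianSpace hW
  have hbG (j : Fin n) : (fun ω ↦ b ω j) ∈ gaussianSpace μ W :=
    Submodule.sub_mem _ ((hwj j).mem_gaussianSpace hW) (haG j)
  have ha2 : MemLp a 2 μ := memLp_of_forall_coord fun j ↦ (haG j).1
  have hb2 : MemLp b 2 μ := memLp_of_forall_coord fun j ↦ (hbG j).1
  have hind : Indep (wienerFiltration W 0)
      (MeasurableSpace.comap (fun ω j ↦ b ω j) inferInstance) μ := by
    -- The residual of a conditional expectation is orthogonal to every square integrable past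
    -- variable.
    refine hW.indep_wienerFiltration hbG fun j s hs x ↦ ?_
    have hxm : Measurable[wienerFiltration W 0] fun ω ↦ ⟪x, W s ω⟫ :=
      Measurable.const_inner (measurable_iff_comap_le.2 (le_iSup₂_of_le s hs le_rfl))
    have hx2 : MemLp (fun ω ↦ ⟪x, W s ω⟫) 2 μ :=
      (hW.wienerSpan_le_gaussianSpace (Submodule.subset_span ⟨(x, s), rfl⟩)).1
    have hint : Integrable ((fun ω ↦ w ω j) * fun ω ↦ ⟪x, W s ω⟫) μ :=
      (hw j).2.1.integrable_mul hx2
    have h1 := condExp_mul_of_stronglyMeasurable_right hxm.stronglyMeasurable hint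
      ((hw j).2.1.integrable one_le_two)
    have h2 : ∫ ω, a ω j * ⟪x, W s ω⟫ ∂μ = ∫ ω, w ω j * ⟪x, W s ω⟫ ∂μ := by
      have h3 := integral_condExp (μ := μ) (f := (fun ω ↦ w ω j) * fun ω ↦ ⟪x, W s ω⟫) hle
      rw [integral_congr_ae h1] at h3
      exact h3
    have h4 : ∫ ω, ⟪x, W s ω⟫ * b ω j ∂μ =
        ∫ ω, (w ω j * ⟪x, W s ω⟫ - a ω j * ⟪x, W s ω⟫) ∂μ := by
      refine integral_congr_ae ?_
      filter_upwards [hwmk] with ω hω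
      simp only [hb, PiLp.sub_apply, ← hω]
      ring
    have h5 : Integrable (fun ω ↦ a ω j * ⟪x, W s ω⟫) μ := (haG j).1.integrable_mul hx2
    have h6 : Integrable (fun ω ↦ w ω j * ⟪x, W s ω⟫) μ := hint
    rw [h4, integral_sub h6 h5, h2, sub_self]
  have hindM : Indep (wienerFiltration W 0)
      (MeasurableSpace.comap (fun ω ↦ M (b ω)) inferInstance) μ := by
    refine indep_of_indep_of_le_right hind ?_
    have h1 : (fun ω ↦ M (b ω)) =
        (fun z : Fin n → ℝ ↦ M (WithLp.toLp 2 z)) ∘ fun ω j ↦ b ω j := rfl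
    conv_lhs => rw [h1, ← MeasurableSpace.comap_comp]
    exact MeasurableSpace.comap_mono (measurable_iff_comap_le.1 (by fun_prop))
  have hindab (x : E n) : ∫ ω, ⟪x, a ω⟫ * ⟪x, b ω⟫ ∂μ = 0 := by
    have h1 : IndepFun a (fun ω j ↦ b ω j) μ := by
      rw [IndepFun_iff_Indep]
      exact indep_of_indep_of_le_left hind (measurable_iff_comap_le.1 ham)
    have h2 : IndepFun (fun ω ↦ ⟪x, a ω⟫) (fun ω ↦ ⟪x, b ω⟫) μ :=
      h1.comp (show Measurable fun z : E n ↦ ⟪x, z⟫ by fun_prop)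
        (show Measurable fun z : Fin n → ℝ ↦ ⟪x, (WithLp.toLp 2 z : E n)⟫ by fun_prop)
    have h3 := h2.integral_mul_eq_mul_integral (inner_mem_gaussianSpace haG x).1.1
      (inner_mem_gaussianSpace hbG x).1.1
    simp only [Pi.mul_apply] at h3
    rw [h3, (hW.hasGaussianLaw_and_integral_of_mem (inner_mem_gaussianSpace haG x)).2, zero_mul]
  have hsq (x : E n) :
      ∫ ω, ⟪x, a ω⟫ ^ 2 ∂μ + ∫ ω, ⟪x, b ω⟫ ^ 2 ∂μ = ∫ ω, ⟪x, w ω⟫ ^ 2 ∂μ := by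
    have hA := (inner_mem_gaussianSpace haG x).1
    have hB := (inner_mem_gaussianSpace hbG x).1
    have hAB : Integrable (fun ω ↦ ⟪x, a ω⟫ * ⟪x, b ω⟫) μ := hA.integrable_mul hB
    have h1 : ∫ ω, ⟪x, w ω⟫ ^ 2 ∂μ =
        ∫ ω, (⟪x, a ω⟫ ^ 2 + ⟪x, b ω⟫ ^ 2 + 2 * (⟪x, a ω⟫ * ⟪x, b ω⟫)) ∂μ := by
      refine integral_congr_ae ?_
      filter_upwards [hwmk] with ω hω
      simp only [hb, inner_sub_right, ← hω]
      ring
    have h2 : Integrable (fun ω ↦ ⟪x, a ω⟫ ^ 2 + ⟪x, b ω⟫ ^ 2) μ :=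
      hA.integrable_sq.add hB.integrable_sq
    rw [h1, integral_add h2 (hAB.const_mul 2),
      integral_add hA.integrable_sq hB.integrable_sq, integral_const_mul, hindab]
    ring
  have hMa (x : E n) : (fun ω ↦ ⟪x, M (a ω)⟫) ∈ gaussianSpace μ W := by
    simp_rw [hMM']
    exact inner_mem_gaussianSpace haG _
  have hMb (x : E n) : (fun ω ↦ ⟪x, M (b ω)⟫) ∈ gaussianSpace μ W := by
    simp_rw [hMM']
    exact inner_mem_gaussianSpace hbG _
  have hab (x : E n) : ∫ ω, ⟪x, M (a ω)⟫ ^ 2 ∂μ + ∫ ω, ⟪x, M (b ω)⟫ ^ 2 ∂μ = ‖x‖ ^ 2 := by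
    have h := integral_inner_toEuclideanCLM_sq hw2 hN x
    simp_rw [← hM, hMM'] at h ⊢
    rw [hsq, h]
  have hca (x : E n) : ∫ ω, ⟪x, M (a ω)⟫ ^ 2 ∂μ ≤ c * ‖x‖ ^ 2 := by
    -- In the first case Cauchy-Schwarz bounds the covariance of `M a` by `‖M'‖²` times the trace of
    -- that of `a`, which the isometry computes. In the case `c = 1` the bound is automatic from
    -- `hab`.
    rcases hc with hc | rfl
    · have h1 (j : Fin n) : ∫ ω, a ω j ^ 2 ∂μ = ∫ u in Set.Iic 0, ⟪h j u, h j u⟫ := by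
        simp_rw [sq]
        rw [(haW j).integral_mul hW (haW j), ← integral_indicator measurableSet_Iic]
        congr 1 with u
        by_cases hu : u ∈ Set.Iic (0 : ℝ)
        · simp only [Set.indicator_of_mem hu]
        · simp [Set.indicator_of_notMem hu]
      have h2 : ∫ ω, ‖a ω‖ ^ 2 ∂μ = ∑ j, ∫ u in Set.Iic 0, ⟪h j u, h j u⟫ := by
        simp_rw [EuclideanSpace.real_norm_sq_eq, ← h1]
        exact integral_finsetSum _ fun j _ ↦ (haG j).1.integrable_sq
      calc ∫ ω, ⟪x, M (a ω)⟫ ^ 2 ∂μ ≤ ∫ ω, ‖M' x‖ ^ 2 * ‖a ω‖ ^ 2 ∂μ := by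
            refine integral_mono (hMa x).1.integrable_sq (ha2.integrable_norm_pow'.const_mul _)
              fun ω ↦ ?_
            simp only
            rw [hMM', ← mul_pow, ← sq_abs]
            gcongr
            exact abs_real_inner_le_norm _ _
        _ = ‖M' x‖ ^ 2 * ∑ j, ∫ u in Set.Iic 0, ⟪h j u, h j u⟫ := by
            rw [integral_const_mul, h2]
        _ ≤ (‖M'‖ * ‖x‖) ^ 2 * ∑ j, ∫ u in Set.Iic 0, ⟪h j u, h j u⟫ := by
            gcongr
            · exact Finset.sum_nonneg fun j _ ↦ integral_nonneg fun u ↦ real_inner_self_nonneg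
            · exact M'.le_opNorm x
        _ ≤ c * ‖x‖ ^ 2 := by
            rw [mul_pow, mul_right_comm]
            gcongr
    · have h1 := hab x
      have h2 : 0 ≤ ∫ ω, ⟪x, M (b ω)⟫ ^ 2 ∂μ := integral_nonneg fun ω ↦ sq_nonneg _
      linarith
  have hkey := eLpNorm_condExp_comp_add_le hle (a := fun ω ↦ M (a ω)) (b := fun ω ↦ M (b ω))
    (M.continuous.measurable.comp ham) (M.continuous.measurable.comp hbm) hindM
    (M.comp_memLp' ha2)
    (charFun_map_of_mem hW hMa (M.continuous.measurable.comp_aemeasurable ha2.1.aemeasurable))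
    (charFun_map_of_mem hW hMb (M.continuous.measurable.comp_aemeasurable hb2.1.aemeasurable))
    hab hc0 hc1 hca hF hk
  refine le_trans (le_of_eq (eLpNorm_congr_ae (condExp_congr_ae ?_))) hkey
  filter_upwards [hwmk] with ω hω
  simp only [hb, map_sub, ← hω]
  congr 1
  abel

end

/-! ### Standardization -/

section

variable {n : ℕ} {S O : Matrix (Fin n) (Fin n) ℝ} {D : Fin n → ℝ}

/-- Congruence by the invertible `O` preserves semidefiniteness and rank, and a zero diagonal entry
would lower the rank. -/
lemma pos_of_transpose_mul_mul_eq_diagonal (hS : S.PosSemidef) (hrank : S.rank = n)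
    (hO : O ∈ Matrix.orthogonalGroup (Fin n) ℝ) (hD : Oᵀ * S * O = Matrix.diagonal D)
    (i : Fin n) : 0 < D i := by
  have h1 : O * Oᵀ = 1 := (Matrix.mem_orthogonalGroup_iff _ _).1 hO
  have hu : IsUnit O.det := Matrix.isUnit_det_of_right_inverse h1
  have hu' : IsUnit Oᵀ.det := Matrix.isUnit_det_of_left_inverse h1
  have hnn : 0 ≤ D i := by
    have h2 := (hS.conjTranspose_mul_mul_same O).diag_nonneg (i := i)
    rw [Matrix.conjTranspose_eq_transpose_of_trivial, hD, Matrix.diagonal_apply_eq] at h2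
    exact h2
  have hr : (Matrix.diagonal D).rank = n := by
    rw [← hD, Matrix.rank_mul_eq_left_of_isUnit_det _ _ hu,
      Matrix.rank_mul_eq_right_of_isUnit_det _ _ hu', hrank]
  rw [Matrix.rank_diagonal, Fintype.card_subtype_compl, Fintype.card_fin] at hr
  refine lt_of_le_of_ne hnn fun h0 ↦ ?_
  have h3 : 0 < Fintype.card {j // D j = 0} := Fintype.card_pos_iff.2 ⟨⟨i, h0.symm⟩⟩
  have h4 : 0 < n := i.pos
  omega

lemma invSqrtDiag_mul_mul_transpose_eq_one (hpos : ∀ i, 0 < D i)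
    (hD : Oᵀ * S * O = Matrix.diagonal D) :
    invSqrtDiag D * Oᵀ * S * (invSqrtDiag D * Oᵀ)ᵀ = 1 := by
  have h : invSqrtDiag D * Oᵀ * S * (invSqrtDiag D * Oᵀ)ᵀ =
      invSqrtDiag D * (Oᵀ * S * O) * invSqrtDiag D := by
    rw [Matrix.transpose_mul, Matrix.transpose_transpose, invSqrtDiag, Matrix.diagonal_transpose]
    simp only [Matrix.mul_assoc]
  rw [h, hD, invSqrtDiag, Matrix.diagonal_mul_diagonal, Matrix.diagonal_mul_diagonal,
    ← Matrix.diagonal_one]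
  congr 1 with i
  have h1 := Real.sqrt_pos.2 (hpos i)
  nth_rw 2 [← Real.mul_self_sqrt (hpos i).le]
  field_simp

lemma mul_sqrtDiag_mul_invSqrtDiag_mul_transpose (hpos : ∀ i, 0 < D i)
    (hO : O ∈ Matrix.orthogonalGroup (Fin n) ℝ) :
    O * sqrtDiag D * (invSqrtDiag D * Oᵀ) = 1 := by
  have h : sqrtDiag D * invSqrtDiag D = 1 := by
    rw [sqrtDiag, invSqrtDiag, Matrix.diagonal_mul_diagonal, ← Matrix.diagonal_one]
    congr 1 with i
    exact mul_inv_cancel₀ (Real.sqrt_pos.2 (hpos i)).ne'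
  rw [Matrix.mul_assoc, ← Matrix.mul_assoc (sqrtDiag D), h, Matrix.one_mul]
  exact (Matrix.mem_orthogonalGroup_iff _ _).1 hO

/-- A nonzero integral would give `hermiteRank ≤ |l| ≤ ⌊b⌋ ≤ b`. The strict inequality in `hG` is
what allows degree `⌊b⌋` itself. -/
lemma integral_comp_mul_hermiteMulti_eq_zero {G : E n → ℝ} {b : ℝ} (hb : 0 ≤ b)
    (hG : ENNReal.ofReal b < (hermiteRank O D G : ℝ≥0∞)) {l : Fin n → ℕ}
    (hl : ∑ i, l i < ⌊b⌋₊ + 1) :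
    ∫ x, G (Matrix.toEuclideanCLM (𝕜 := ℝ) (O * sqrtDiag D) x) * hermiteMulti l x
      ∂(stdGaussian (E n)) = 0 := by
  by_contra hne
  have hc : hermiteCoeff O D G l ≠ 0 := by
    refine mul_ne_zero (inv_ne_zero (Finset.prod_ne_zero_iff.2 fun i _ ↦ ?_)) hne
    exact_mod_cast (Nat.factorial_pos _).ne'
  have h1 : hermiteRank O D G ≤ ((∑ i, l i : ℕ) : ℕ∞) := iInf₂_le l hc
  have h2 : (hermiteRank O D G : ℝ≥0∞) ≤ ((∑ i, l i : ℕ) : ℝ≥0∞) := by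
    have := ENat.toENNReal_le.2 h1
    rwa [ENat.toENNReal_coe] at this
  refine absurd (hG.trans_le h2) (not_lt.2 ?_)
  rw [← ENNReal.ofReal_natCast]
  exact ENNReal.ofReal_le_ofReal
    ((Nat.cast_le.2 (Nat.lt_succ_iff.1 hl)).trans (Nat.floor_le hb))

end

/-! ### Moving averages -/

section

variable {Ω : Type*} {mΩ : MeasurableSpace Ω} {μ : Measure Ω} {n d : ℕ} {W : ℝ → Ω → E d}
  {K : ℝ → Matrix (Fin n) (Fin d) ℝ} {v : ℝ≥0 → Ω → E n}

/-- Stationarity: by the isometry the moments are integrals over `u` of functions of `t - u`, and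
Lebesgue measure is invariant under `u ↦ t - u`. -/
lemma momentMatrix_movingAverage (hW : IsWienerProcess μ W) (hv : IsMovingAverage μ W K v)
    (s t : ℝ≥0) : momentMatrix μ (v s) = momentMatrix μ (v t) := by
  ext i j
  simp only [momentMatrix, Matrix.of_apply]
  rw [(hv s i).integral_mul hW (hv s j), (hv t i).integral_mul hW (hv t j),
    integral_sub_left_eq_self (fun u ↦ ⟪kernelRow K i u, kernelRow K j u⟫) volume (s : ℝ),
    integral_sub_left_eq_self (fun u ↦ ⟪kernelRow K i u, kernelRow K j u⟫) volume (t : ℝ)]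

lemma setIntegral_Iic_sub {g : ℝ → ℝ} (s : ℝ) :
    ∫ u in Set.Iic 0, g (s - u) = ∫ u in Set.Iic (-s), g (-u) := by
  rw [← integral_indicator measurableSet_Iic, ← integral_indicator measurableSet_Iic,
    ← integral_sub_right_eq_self ((Set.Iic (-s)).indicator fun u ↦ g (-u)) s]
  congr 1 with u
  by_cases hu : u ≤ 0
  · rw [Set.indicator_of_mem (show u ∈ Set.Iic (0 : ℝ) from hu),
      Set.indicator_of_mem (show u - s ∈ Set.Iic (-s) by simpa using hu), neg_sub]
  · rw [Set.indicator_of_notMem (show u ∉ Set.Iic (0 : ℝ) from hu),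
      Set.indicator_of_notMem (show u - s ∉ Set.Iic (-s) by simpa using hu)]

lemma KernelDecay.sum_le {β Θ : ℝ} (hK : KernelDecay K β Θ) (s : ℝ≥0) :
    ∑ j, ∫ u in Set.Iic 0, ⟪kernelRow K j (s - u), kernelRow K j (s - u)⟫ ≤
      n * Θ * (max 1 (s : ℝ)) ^ (-(2 * β)) := by
  have h (j : Fin n) : ∫ u in Set.Iic 0, ⟪kernelRow K j (s - u), kernelRow K j (s - u)⟫ ≤
      Θ * (max 1 (s : ℝ)) ^ (-(2 * β)) := by
    rw [setIntegral_Iic_sub (g := fun u ↦ ⟪kernelRow K j u, kernelRow K j u⟫)]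
    exact (le_abs_self _).trans (hK s s.2 j)
  refine (Finset.sum_le_sum fun j _ ↦ h j).trans (le_of_eq ?_)
  rw [Finset.sum_const, Finset.card_univ, Fintype.card_fin, nsmul_eq_mul, mul_assoc]

lemma lintegral_max_one_rpow_lt_top {r : ℝ} (hr : r < -1) :
    ∫⁻ s in Set.Ici (0 : ℝ), ENNReal.ofReal ((max 1 s) ^ r) < ∞ := by
  have hsub : Set.Ici (0 : ℝ) ⊆ Set.Icc 0 1 ∪ Set.Ioi 1 := fun s hs ↦ by
    rcases le_or_gt s 1 with h | h
    · exact Or.inl ⟨hs, h⟩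
    · exact Or.inr h
  refine (lintegral_mono_set hsub).trans_lt ((lintegral_union_le _ _ _).trans_lt
    (ENNReal.add_lt_top.2 ⟨?_, ?_⟩))
  · rw [setLIntegral_congr_fun measurableSet_Icc (g := fun _ ↦ 1) fun s hs ↦ by
      simp [max_eq_left hs.2]]
    simp
  · rw [setLIntegral_congr_fun measurableSet_Ioi (g := fun s ↦ ENNReal.ofReal (s ^ r))
      fun s hs ↦ by simp [max_eq_right (le_of_lt (Set.mem_Ioi.1 hs))]]
    exact (integrableOn_Ioi_rpow_of_lt hr one_pos).lintegral_lt_top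

lemma sqrt_min_pow_le {C x β : ℝ} (hC : 0 ≤ C) (hx : 1 ≤ x) (k : ℕ) :
    √(min 1 (C * x ^ (-(2 * β)))) ^ k ≤ √C ^ k * x ^ (-(β * k)) := by
  have hx0 : 0 ≤ x := zero_le_one.trans hx
  have h1 : √(x ^ (-(2 * β))) = x ^ (-β) := by
    rw [show -(2 * β) = -β * (2 : ℕ) by push_cast; ring, Real.rpow_mul_natCast hx0,
      Real.sqrt_sq (Real.rpow_nonneg hx0 _)]
  calc √(min 1 (C * x ^ (-(2 * β)))) ^ k ≤ √(C * x ^ (-(2 * β))) ^ k := by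
        gcongr
        exact min_le_right _ _
    _ = √C ^ k * x ^ (-(β * k)) := by
        rw [Real.sqrt_mul hC, h1, mul_pow, ← Real.rpow_mul_natCast hx0, neg_mul]

end

/-! ### Transfer between `y` and its moving average realization -/

section

variable {Ω' : Type*} {mΩ' : MeasurableSpace Ω'} {P : Measure Ω'}
  {Ω : Type*} {mΩ : MeasurableSpace Ω} {μ : Measure Ω} {n d : ℕ} {y : ℝ≥0 → Ω' → E n}
  {W : ℝ → Ω → E d} {K : ℝ → Matrix (Fin n) (Fin d) ℝ} {v : ℝ≥0 → Ω → E n}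

lemma IsVolterraProcess.identDistrib (hy : IsVolterraProcess P y μ W K v) (t : ℝ≥0) :
    IdentDistrib (y t) (v t) P μ :=
  (hy.law_eq {t}).comp
    (u := fun z : ({t} : Finset ℝ≥0) → E n ↦ z ⟨t, Finset.mem_singleton_self t⟩)
    (measurable_pi_apply _)

lemma IsVolterraProcess.momentMatrix_eq (hy : IsVolterraProcess P y μ W K v) (s : ℝ≥0) :
    momentMatrix μ (v s) = secondMoment P y := by
  rw [momentMatrix_movingAverage hy.wiener hy.moving_average s 0]
  ext i j
  exact ((hy.identDistrib 0).comp (u := fun z : E n ↦ z i * z j) (by fun_prop)).integral_eq.symm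

end

end Volterra

end

/-! ### Whitening, contraction at a fixed time, and integration over time -/

theorem mainTheorem5 {n d : ℕ}
    {Ω' : Type*} [MeasurableSpace Ω'] (P : Measure Ω') [IsProbabilityMeasure P]
    {Ω : Type*} [MeasurableSpace Ω] (μ : Measure Ω) [IsProbabilityMeasure μ]
    (β Θ : ℝ) (hβ : 0 < β) (hΘ : 0 < Θ)
    (y : ℝ≥0 → Ω' → Volterra.E n)
    (W : ℝ → Ω → Volterra.E d) (K : ℝ → Matrix (Fin n) (Fin d) ℝ) (v : ℝ≥0 → Ω → Volterra.E n)
    (hy : Volterra.IsVolterraProcess P y μ W K v)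
    (hK : Volterra.KernelDecay K β Θ)
    (hrank : (Volterra.secondMoment P y).rank = n)
    (O : Matrix (Fin n) (Fin n) ℝ) (D : Fin n → ℝ)
    (hO : O ∈ Matrix.orthogonalGroup (Fin n) ℝ)
    (hD : Oᵀ * Volterra.secondMoment P y * O = Matrix.diagonal D)
    (G : Volterra.E n → ℝ)
    (hG : MemLp G 2 (multivariateGaussian 0 (Volterra.secondMoment P y)))
    (hGrank : ENNReal.ofReal (2 / β) < (Volterra.hermiteRank O D G : ℝ≥0∞))
    (hGdecay : Volterra.FastChaosDecay O D G (Volterra.thetaHat O D Θ * (2 * n - 1) + 1)) :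
    Volterra.ConditionalDecay P y μ W v G := by
  have hW := hy.wiener
  have hmem (s : ℝ≥0) (j : Fin n) : (fun ω ↦ v s ω j) ∈ Volterra.gaussianSpace μ W :=
    (hy.moving_average s j).mem_gaussianSpace hW
  have hv2 (s : ℝ≥0) : MemLp (v s) 2 μ := Volterra.memLp_of_forall_coord fun j ↦ (hmem s j).1
  have hlaw (s : ℝ≥0) : μ.map (v s) = multivariateGaussian 0 (Volterra.secondMoment P y) := by
    rw [Volterra.map_eq_multivariateGaussian hW (hmem s), hy.momentMatrix_eq]
  have hS : (Volterra.secondMoment P y).PosSemidef := by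
    rw [← hy.momentMatrix_eq 0]
    exact Volterra.posSemidef_momentMatrix (hv2 0)
  have hpos := Volterra.pos_of_transpose_mul_mul_eq_diagonal hS hrank hO hD
  set N := Volterra.invSqrtDiag D * Oᵀ with hNdef
  set M := Matrix.toEuclideanCLM (𝕜 := ℝ) N with hM
  set T := Matrix.toEuclideanCLM (𝕜 := ℝ) (O * Volterra.sqrtDiag D) with hT
  have hN (s : ℝ≥0) : N * Volterra.momentMatrix μ (v s) * Nᵀ = 1 := by
    rw [hy.momentMatrix_eq]
    exact Volterra.invSqrtDiag_mul_mul_transpose_eq_one hpos hD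
  have hTM (x : Volterra.E n) : T (M x) = x := by
    have h : T * M = 1 := by
      rw [hT, hM, ← map_mul, Volterra.mul_sqrtDiag_mul_invSqrtDiag_mul_transpose hpos hO, map_one]
    exact congr($h x)
  have hMlaw : μ.map (M ∘ v 0) = stdGaussian (Volterra.E n) := by
    have hm : AEMeasurable (M ∘ v 0) μ :=
      M.continuous.measurable.comp_aemeasurable (hv2 0).1.aemeasurable
    have := Measure.isProbabilityMeasure_map hm
    refine Measure.ext_of_charFun ?_
    ext x
    rw [Volterra.charFun_map_of_mem hW (fun x ↦ ?_) hm,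
      charFun_stdGaussian]
    · simp_rw [Function.comp_apply, hM, Volterra.integral_inner_toEuclideanCLM_sq (hv2 0) (hN 0)]
      push_cast
      rfl
    · simp_rw [Function.comp_apply, hM, Volterra.inner_toEuclideanCLM_eq]
      exact Volterra.inner_mem_gaussianSpace (hmem 0) _
  -- `T` undoes the whitening, so square integrability and moments of `G` pass to `G ∘ T` under the
  -- standard Gaussian.
  have hTlaw : (stdGaussian (Volterra.E n)).map T =
      multivariateGaussian 0 (Volterra.secondMoment P y) := by
    rw [← hMlaw, AEMeasurable.map_map_of_aemeasurable T.continuous.measurable.aemeasurable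
      (M.continuous.measurable.comp_aemeasurable (hv2 0).1.aemeasurable), ← hlaw 0]
    congr 1 with ω : 1
    exact hTM _
  have hF : MemLp (G ∘ T) 2 (stdGaussian (Volterra.E n)) := by
    rw [← hTlaw] at hG
    exact hG.comp_of_map T.continuous.measurable.aemeasurable
  have hherm (l : Fin n → ℕ) (hl : ∑ i, l i < ⌊2 / β⌋₊ + 1) :
      ∫ x, (G ∘ T) x * Volterra.hermiteMulti l x ∂(stdGaussian (Volterra.E n)) = 0 :=
    Volterra.integral_comp_mul_hermiteMulti_eq_zero (div_nonneg zero_le_two hβ.le) hGrank hl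
  have hylaw : P.map (y 0) = multivariateGaussian 0 (Volterra.secondMoment P y) := by
    rw [(hy.identDistrib 0).map_eq, hlaw]
  refine ⟨?_, ?_, fun s ↦ ?_, ?_⟩
  · rw [← hylaw] at hG
    exact (hG.comp_of_map (hy.identDistrib 0).aemeasurable_fst).integrable one_le_two
  -- The coefficient of the constant Hermite polynomial is the mean; it vanishes because `⌊2 / β⌋₊ +
  -- 1` is positive.
  · have h0 := hherm 0 (by simp)
    simp only [Volterra.hermiteMulti, Pi.zero_apply, Polynomial.hermite_zero, map_one,
      Finset.prod_const_one, mul_one, Function.comp_apply] at h0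
    have hGm := hG.1
    rw [← integral_map (hy.identDistrib 0).aemeasurable_fst (by rwa [hylaw]), hylaw, ← hTlaw,
      integral_map T.continuous.measurable.aemeasurable (by rwa [hTlaw]), h0]
  · rw [← hlaw s] at hG
    exact (hG.comp_of_map (hv2 s).1.aemeasurable).integrable one_le_two
  set k := ⌊2 / β⌋₊ + 1 with hk
  -- The norm comes from whitening, and the factor `n` from bounding the trace by the sum of the `n`
  -- row energies.
  set C := ‖Matrix.toEuclideanCLM (𝕜 := ℝ) Nᵀ‖ ^ 2 * (n * Θ) with hC
  have hC0 : 0 ≤ C := by positivity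
  have hkβ : -(β * k) < -1 := by
    have h1 : 2 / β < k := by
      rw [hk]
      exact_mod_cast Nat.lt_floor_add_one (2 / β)
    rw [div_lt_iff₀ hβ] at h1
    linarith
  have hbound (s : ℝ≥0) :
      eLpNorm (μ[fun ω ↦ G (v s ω) | Volterra.wienerFiltration W 0]) 2 μ ≤
        ENNReal.ofReal (√C ^ k) * eLpNorm (G ∘ T) 2 (stdGaussian (Volterra.E n)) *
          ENNReal.ofReal ((max 1 (s : ℝ)) ^ (-(β * k))) := by
    -- The cap at `1` keeps `√(1 - c)` meaningful at small times, where the decay estimate may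
    -- exceed `1`.
    set c := min 1 (C * (max 1 (s : ℝ)) ^ (-(2 * β))) with hc
    have hc0 : 0 ≤ c := by positivity
    have h1 := Volterra.eLpNorm_condExp_comp_wienerIntegral_le hW (w := v s)
      (hy.moving_average s) (hN s) hc0 (min_le_left _ _) (by
        rcases min_choice 1 (C * (max 1 (s : ℝ)) ^ (-(2 * β))) with h | h
        · exact Or.inr h
        · refine Or.inl ?_
          rw [hc, h, hC, mul_assoc]
          exact mul_le_mul_of_nonneg_left (hK.sum_le s) (by positivity)) hF hherm
    simp only [Function.comp_apply, ← hM, hTM] at h1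
    refine h1.trans ?_
    rw [mul_right_comm, ← ENNReal.ofReal_mul (by positivity)]
    gcongr
    exact Volterra.sqrt_min_pow_le hC0 (le_max_left _ _) k
  calc ∫⁻ s in Set.Ici (0 : ℝ),
        eLpNorm (μ[fun ω ↦ G (v s.toNNReal ω) | Volterra.wienerFiltration W 0]) 2 μ
      ≤ ∫⁻ s in Set.Ici (0 : ℝ),
        ENNReal.ofReal (√C ^ k) * eLpNorm (G ∘ T) 2 (stdGaussian (Volterra.E n)) *
          ENNReal.ofReal ((max 1 s) ^ (-(β * k))) := by
        refine setLIntegral_mono' measurableSet_Ici fun s hs ↦ ?_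
        have h := hbound s.toNNReal
        rwa [Real.coe_toNNReal s hs] at h
    _ = ENNReal.ofReal (√C ^ k) * eLpNorm (G ∘ T) 2 (stdGaussian (Volterra.E n)) *
        ∫⁻ s in Set.Ici (0 : ℝ), ENNReal.ofReal ((max 1 s) ^ (-(β * k))) :=
        lintegral_const_mul _ (by fun_prop)
    _ < ∞ := ENNReal.mul_lt_top (ENNReal.mul_lt_top ENNReal.ofReal_lt_top hF.2)
        (Volterra.lintegral_max_one_rpow_lt_top hkβ)
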